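/- A \emph{partial affine plane} of order $n$ ($n\ge 2$) is a pair $\mathcal I=(\mathcal S,\mathcal A)$ where $\mathcal S$ is a set of $n^2$ points and $\mathcal A$ is a set of subsets of $\mathcal S$, called lines, such that every line has exactly $n$ points and any two distinct lines meet in at most one point. It is an \emph{affine plane} of order $n$ if moreover any two distinct points lie on exactly one common line, for every line $\ell$ and every point $p\notin\ell$ there is exactly one line through $p$ disjoint from $\ell$, and there are three non-collinear points. Two lines are \emph{parallel} if they coincide or have no point in common. A partial affine plane $(\mathcal S,\mathcal A)$ of order $n$ \emph{can be extended to an affine plane of order $n$} if there is a set $\mathcal A'\supseteq\mathcal A$ of subsets of $\mathcal S$ such that $(\mathcal S,\mathcal A')$ is an affine plane of order $n$. Let $n\ge 49$ and let $\mathcal I=(\mathcal S,\mathcal A)$ be a partial affine plane of order $n$ in which parallelism is an equivalence relation on $\mathcal A$. If $|\mathcal A|>n^2-\sqrt n$, or if $|\mathcal A|\ge n^2-\sqrt{2n}+1$ and every point of $\mathcal S$ lies on at least one line of $\mathcal A$, then $\mathcal I$ can be extended to an affine plane of order $n$. -/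

import Mathlib

/-- `L` is the line set of a partial affine plane of order `n` with point set `P`: `n ≥ 2`,
there are `n ^ 2` points, every line is a set of `n` points, and any two distinct lines meet
in at most one point. -/
structure IsPartialAffinePlane {P : Type*} [Fintype P] [DecidableEq P]
    (n : ℕ) (L : Finset (Finset P)) : Prop where
  two_le : 2 ≤ n
  card_points : Fintype.card P = n ^ 2
  card_line : ∀ l ∈ L, l.card = n
  card_inter_le_one : ∀ l ∈ L, ∀ m ∈ L, l ≠ m → (l ∩ m).card ≤ 1

/-- `L` is the line set of an affine plane of order `n ≥ 2` with point set `P`: through any two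
distinct points there is a unique line; for any line `l` and point `p` not on `l` there is a unique
line through `p` disjoint from `l`; there are three points that are not collinear. Order `n` means
that there are `n ^ 2` points and `n` points on each line. -/
structure IsAffinePlane {P : Type*} [Fintype P]
    (n : ℕ) (L : Finset (Finset P)) : Prop where
  two_le : 2 ≤ n
  card_points : Fintype.card P = n ^ 2
  card_line : ∀ l ∈ L, l.card = n
  existsUnique_line : ∀ p q : P, p ≠ q → ∃! l : Finset P, l ∈ L ∧ p ∈ l ∧ q ∈ l
  existsUnique_parallel : ∀ l ∈ L, ∀ p : P, p ∉ l →
    ∃! m : Finset P, m ∈ L ∧ p ∈ m ∧ Disjoint l m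
  exists_not_collinear : ∃ p q r : P, ¬ ∃ l ∈ L, p ∈ l ∧ q ∈ l ∧ r ∈ l

/-- Two lines are parallel if they coincide or have no point in common. -/
def Parallel {P : Type*} (l m : Finset P) : Prop :=
  l = m ∨ Disjoint l m

/-- Parallelism is an equivalence relation on the set `L` of lines. -/
def ParallelismIsEquivalence {P : Type*} (L : Finset (Finset P)) : Prop :=
  Equivalence (fun l m : {l : Finset P // l ∈ L} => Parallel l.1 m.1)

/-- The structure with line set `L` extends to an affine plane of order `n`: lines can be added,
on the same point set, so as to obtain an affine plane of order `n`. -/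
def ExtendsToAffinePlane {P : Type*} [Fintype P] (n : ℕ) (L : Finset (Finset P)) : Prop :=
  ∃ L' : Finset (Finset P), L ⊆ L' ∧ IsAffinePlane n L'

/-! The proof dualises. The lines of `L` become the points of a linear space whose blocks are the
points of `P` and the parallel classes: two distinct lines share either one point or one class, and
each line lies on `n` points and in one class. If there are at most `n + 1` classes, empty ones
bring their number to `n + 1`, and there are `n ^ 2 + n + 1` blocks, as in a projective plane of
order `n` with some points deleted. A deleted point would show as `n + 1` blocks that partition the
remaining points. Such a parallel class of blocks, when made of `n` points and one class, is a line
that can be added (`exists_insert_of_isParallelClass`). Lines are added one at a time until there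
are `n ^ 2 + n`; then every point has full degree and the plane is affine
(`isAffinePlane_of_le_card`).

Parallel classes of blocks are found in the graph of disjointness, in the spirit of Bruck's
completion of nets. A block of deficit `d` has `n * d` neighbours, and common neighbours are counted
by deficits alone (`card_nbrs_inter_nbrs`). A block of deficit one forms a parallel class with its
neighbours. A block of deficit two has `2 * n` neighbours, mostly of deficit two; a claw among these
is too expensive, so they split into two near-cliques, and counting points covered twice shows that
both are parallel classes (`exists_parallelClass_pair`).

That there are at most `n + 1` classes follows from first and second moments of point degrees and
class sizes (`card_classes_le`). Only there do the two alternative hypotheses play different roles.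
-/

namespace PartialAffine
open Finset

/-- The blocks `I C` form a linear space with point set `V` in which every point has degree
`n + 1`; empty and repeated blocks are allowed. -/
structure IsRegularLinearSpace {V β : Type*} [DecidableEq V] [Fintype β]
    (n : ℕ) (I : β → Finset V) : Prop where
  card_blocks : ∀ x, (univ.filter fun C => x ∈ I C).card = n + 1
  card_join : ∀ x y, x ≠ y → (univ.filter fun C => x ∈ I C ∧ y ∈ I C).card = 1

/-- The blocks different from `B` and disjoint from it. -/
def nbrs {V β : Type*} [DecidableEq V] [Fintype β] [DecidableEq β]
    (I : β → Finset V) (B : β) : Finset β :=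
  univ.filter fun C => C ≠ B ∧ Disjoint (I B) (I C)

/-- The number of points that a block lacks to have the maximal size `n + 1`. -/
def deficit {V β : Type*} (n : ℕ) (I : β → Finset V) (B : β) : ℤ := n + 1 - (I B).card

/-- A set of `n + 1` blocks that partition the point set. -/
structure IsParallelClass {V β : Type*} (n : ℕ) (I : β → Finset V) (Z : Finset β) : Prop where
  card_eq : Z.card = n + 1
  existsUnique_mem : ∀ x, ∃! C, C ∈ Z ∧ x ∈ I C

/-! ### Counting in a regular linear space -/

section Design

variable {V β : Type*} [DecidableEq V] [Fintype β] {n : ℕ} {I : β → Finset V}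

theorem card_inter_eq_sum (S T : Finset V) :
    ((S ∩ T).card : ℤ) = ∑ x ∈ S, if x ∈ T then 1 else 0 := by
  rw [← filter_mem_eq_inter, card_filter]; push_cast; rfl

theorem sum_card_inter (h : IsRegularLinearSpace n I) (S : Finset V) :
    ∑ C, ((S ∩ I C).card : ℤ) = (n + 1) * S.card := by
  simp_rw [card_inter_eq_sum]
  rw [sum_comm]
  have : ∀ x ∈ S, (∑ C, if x ∈ I C then (1 : ℤ) else 0) = n + 1 := by
    intro x _
    have := h.card_blocks x
    rw [card_filter] at this
    exact_mod_cast this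
  rw [sum_congr rfl this]
  simp [mul_comm]

/-- A pair `(x, y)` in `S × T` is on one common block if `x ≠ y`, and on `n + 1` if `x = y`. -/
theorem sum_card_inter_mul_card_inter (h : IsRegularLinearSpace n I) (S T : Finset V) :
    ∑ C, ((S ∩ I C).card : ℤ) * (T ∩ I C).card = S.card * T.card + n * (S ∩ T).card := by
  simp_rw [card_inter_eq_sum, sum_mul_sum]
  rw [sum_comm]
  simp_rw [sum_comm (s := univ)]
  have key : ∀ x y, (∑ C, (if x ∈ I C then (1 : ℤ) else 0) * if y ∈ I C then 1 else 0)
      = 1 + if x = y then (n : ℤ) else 0 := by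
    intro x y
    have e : ∀ C, ((if x ∈ I C then (1 : ℤ) else 0) * if y ∈ I C then 1 else 0)
        = if x ∈ I C ∧ y ∈ I C then 1 else 0 := by
      intro C; by_cases h1 : x ∈ I C <;> by_cases h2 : y ∈ I C <;> simp [h1, h2]
    simp_rw [e]
    by_cases hxy : x = y
    · subst hxy
      have := h.card_blocks x
      rw [card_filter] at this
      simp only [and_self, if_true]
      have h2 : (∑ C, if x ∈ I C then (1 : ℤ) else 0) = n + 1 := by exact_mod_cast this
      rw [h2, add_comm]
    · have := h.card_join x y hxy
      rw [card_filter] at this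
      rw [if_neg hxy, add_zero]
      exact_mod_cast this
  simp_rw [key, sum_add_distrib]
  simp [mul_comm]

theorem card_inter_le_one (h : IsRegularLinearSpace n I) {B C : β} (hBC : C ≠ B) :
    (I B ∩ I C).card ≤ 1 := by
  by_contra! hlt
  obtain ⟨x, hx, y, hy, hxy⟩ := one_lt_card.1 hlt
  have h1 := h.card_join x y hxy
  obtain ⟨D, hD⟩ := card_eq_one.1 h1
  rw [mem_inter] at hx hy
  have hB : B ∈ ({D} : Finset β) := by rw [← hD]; simp [hx.1, hy.1]
  have hC : C ∈ ({D} : Finset β) := by rw [← hD]; simp [hx.2, hy.2]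
  exact hBC ((mem_singleton.1 hC).trans (mem_singleton.1 hB).symm)

theorem eq_of_mem_of_mem (h : IsRegularLinearSpace n I) {B C : β} (hBC : C ≠ B) {x y : V}
    (hxB : x ∈ I B) (hxC : x ∈ I C) (hyB : y ∈ I B) (hyC : y ∈ I C) : x = y :=
  card_le_one.1 (card_inter_le_one h hBC) x (by simp [hxB, hxC]) y (by simp [hyB, hyC])

variable [DecidableEq β]

theorem mem_nbrs {B C : β} : C ∈ nbrs I B ↔ C ≠ B ∧ Disjoint (I B) (I C) := by simp [nbrs]

theorem mem_nbrs_comm {B C : β} : C ∈ nbrs I B ↔ B ∈ nbrs I C := by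
  simp [nbrs, disjoint_comm, ne_comm]

theorem notMem_nbrs_self {B : β} : B ∉ nbrs I B := by simp [nbrs]

theorem card_inter_eq_ite (h : IsRegularLinearSpace n I) {B C : β} (hBC : C ≠ B) :
    (1 : ℤ) - (I B ∩ I C).card = if C ∈ nbrs I B then 1 else 0 := by
  have h1 := card_inter_le_one h hBC
  split_ifs with hC
  · rw [mem_nbrs, disjoint_iff_inter_eq_empty] at hC
    simp [hC.2]
  · have : (I B ∩ I C).card ≠ 0 := by
      intro h0
      exact hC (mem_nbrs.2 ⟨hBC, disjoint_iff_inter_eq_empty.2 (card_eq_zero.1 h0)⟩)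
    have : (I B ∩ I C).card = 1 := by omega
    simp [this]

/-- For `C ≠ B`, `1 - |I B ∩ I C|` is the indicator of adjacency. Sums over neighbours thus become
sums over all blocks, which double counting evaluates; the last term removes `C = B`. -/
theorem sum_nbrs (h : IsRegularLinearSpace n I) (B : β) (g : β → ℤ) :
    ∑ C ∈ nbrs I B, g C
      = ∑ C, (1 - ((I B ∩ I C).card : ℤ)) * g C - (1 - (I B).card) * g B := by
  rw [← add_sum_erase univ (fun C => (1 - ((I B ∩ I C).card : ℤ)) * g C) (mem_univ B),
    inter_self, add_sub_cancel_left]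
  have e1 : ∀ C ∈ univ.erase B, (1 - ((I B ∩ I C).card : ℤ)) * g C
      = if C ∈ nbrs I B then g C else 0 := by
    intro C hC
    rw [card_inter_eq_ite h (ne_of_mem_erase hC), ite_mul, one_mul, zero_mul]
  rw [sum_congr rfl e1]
  rw [← sum_filter]
  apply sum_congr _ (fun _ _ => rfl)
  ext C
  simp only [mem_filter, mem_erase, mem_univ, and_true]
  exact ⟨fun hC => ⟨(mem_nbrs.1 hC).1, hC⟩, fun hC => hC.2⟩

/-- Of the `n + 1` blocks on `x`, exactly `|I B|` join `x` to a point of `B`; the others miss `B`.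
-/
theorem card_filter_mem_nbrs (h : IsRegularLinearSpace n I) {B : β} {x : V} (hx : x ∉ I B) :
    (((nbrs I B).filter fun C => x ∈ I C).card : ℤ) = deficit n I B := by
  have h1 := sum_nbrs h B fun C => (({x} ∩ I C).card : ℤ)
  have h2 := sum_card_inter h {x}
  have h3 := sum_card_inter_mul_card_inter h (I B) {x}
  have h4 : ({x} : Finset V) ∩ I B = ∅ := by
    ext y; simp only [mem_inter, mem_singleton, notMem_empty, iff_false]
    rintro ⟨rfl, hy⟩; exact hx hy
  have h4' : I B ∩ ({x} : Finset V) = ∅ := by rw [inter_comm, h4]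
  simp only [sub_mul, one_mul, sum_sub_distrib, h2, h3, h4, h4', card_singleton, card_empty] at h1
  rw [card_filter]
  have h5 : ∀ C, (({x} ∩ I C).card : ℤ) = if x ∈ I C then 1 else 0 := by
    intro C; rw [card_inter_eq_sum, sum_singleton]
  simp only [h5] at h1
  push_cast at h1 ⊢
  rw [h1, deficit]; ring

variable (hb : Fintype.card β = n ^ 2 + n + 1)
include hb

theorem card_nbrs (h : IsRegularLinearSpace n I) (B : β) :
    ((nbrs I B).card : ℤ) = n * deficit n I B := by
  have h1 := sum_nbrs h B fun _ => 1
  have h2 := sum_card_inter h (I B)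
  simp only [mul_one, sum_sub_distrib, h2, sum_const, nsmul_eq_mul, card_univ, hb] at h1
  push_cast at h1
  rw [h1, deficit]; ring

theorem sum_nbrs_one_sub (h : IsRegularLinearSpace n I) (B B' : β) :
    ∑ C ∈ nbrs I B, (1 - ((I B' ∩ I C).card : ℤ))
      = deficit n I B * deficit n I B' - n + n * (I B ∩ I B').card
        - (1 - (I B).card) * (1 - (I B' ∩ I B).card) := by
  rw [sum_nbrs h B]
  have h2 := sum_card_inter h (I B)
  have h2' := sum_card_inter h (I B')
  have h3 := sum_card_inter_mul_card_inter h (I B) (I B')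
  have : ∀ C, (1 - ((I B ∩ I C).card : ℤ)) * (1 - (I B' ∩ I C).card)
      = 1 - (I B ∩ I C).card - (I B' ∩ I C).card + (I B ∩ I C).card * (I B' ∩ I C).card := by
    intro C; ring
  simp only [this, sum_add_distrib, sum_sub_distrib, h2, h2', h3, sum_const, nsmul_eq_mul,
    card_univ, hb, deficit]
  push_cast
  ring

/-- Intersecting blocks of small deficit have few common neighbours, while adjacent blocks have at
least `n - 1`. This gap drives the clique arguments. -/
theorem card_nbrs_inter_nbrs (h : IsRegularLinearSpace n I) {B B' : β} (hne : B' ≠ B) :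
    ((nbrs I B ∩ nbrs I B').card : ℤ)
      = if B' ∈ nbrs I B then n - 1 + (deficit n I B - 1) * (deficit n I B' - 1)
        else deficit n I B * deficit n I B' := by
  have h1 := sum_nbrs_one_sub hb h B B'
  have e1 : ∀ C, (1 - ((I B' ∩ I C).card : ℤ))
      = (if C ∈ nbrs I B' then 1 else 0) + if C = B' then 1 - ((I B').card : ℤ) else 0 := by
    intro C
    by_cases hC : C = B'
    · subst hC; simp [notMem_nbrs_self]
    · rw [card_inter_eq_ite h hC]; simp [hC]
  simp only [e1, sum_add_distrib, sum_ite_eq'] at h1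
  have e2 : ((nbrs I B ∩ nbrs I B').card : ℤ)
      = ∑ C ∈ nbrs I B, if C ∈ nbrs I B' then (1 : ℤ) else 0 := by
    rw [← filter_mem_eq_inter, card_filter]; push_cast; rfl
  have h4 := card_inter_eq_ite h hne
  have h5 : B ∈ nbrs I B' ↔ B' ∈ nbrs I B := mem_nbrs_comm
  rw [if_neg hne.symm] at h1
  simp only [h5] at h1
  rw [e2]
  split_ifs at h1 h4 ⊢ with hB
  · have : ((I B ∩ I B').card : ℤ) = 0 := by linarith
    rw [this] at h1
    rw [eq_sub_of_add_eq h1]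
    simp only [deficit]; ring
  · have : ((I B ∩ I B').card : ℤ) = 1 := by linarith
    rw [this] at h1
    rw [add_zero] at h1
    rw [h1]; ring

/-- For a block of deficit two the total excess over two is `2 * (e - 1)`, so if no neighbour has
deficit below two, few have deficit above two. -/
theorem sum_deficit_nbrs [Fintype V] (h : IsRegularLinearSpace n I) {e : ℤ}
    (hv : (Fintype.card V : ℤ) = n ^ 2 - e) (B : β) :
    ∑ C ∈ nbrs I B, (deficit n I C - 2) = deficit n I B * (e + 1 - deficit n I B) := by
  have h1 := sum_nbrs h B fun C => ((univ ∩ I C).card : ℤ)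
  have h2 := sum_card_inter h (univ : Finset V)
  have h3 := sum_card_inter_mul_card_inter h (I B) univ
  have h4 := card_nbrs hb h B
  simp only [sub_mul, one_mul, sum_sub_distrib, h2, h3, inter_univ, card_univ, hv] at h1
  simp only [univ_inter] at h1
  simp only [deficit, sum_sub_distrib, sum_const, nsmul_eq_mul, h4, h1]
  ring

end Design
-- Two near-cliques among the neighbours of a block of deficit two
section Cliques

variable {V β : Type*} [DecidableEq V] [Fintype β] [DecidableEq β]
  {n : ℕ} {I : β → Finset V} {e : ℤ} {B : β}

/-- The neighbours of `B` of deficit two that are equal or adjacent to `C₁` but not to `C₂`. -/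
def core (n : ℕ) (I : β → Finset V) (B C₁ C₂ : β) : Finset β :=
  (nbrs I B).filter fun C =>
    deficit n I C = 2 ∧ (C = C₁ ∨ C ∈ nbrs I C₁) ∧ C ≠ C₂ ∧ C ∉ nbrs I C₂

/-- The neighbours of `B` that are equal or adjacent to each element of `K`. -/
def side (I : β → Finset V) (B : β) (K : Finset β) : Finset β :=
  (nbrs I B).filter fun D => ∀ E ∈ K, E = D ∨ E ∈ nbrs I D

/-- The points outside `B` that are on two blocks of `X`. -/
def doublePoints [Fintype V] (I : β → Finset V) (B : β) (X : Finset β) : Finset V :=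
  (I B)ᶜ.filter fun y => (X.filter fun C => y ∈ I C).card = 2

/-- Otherwise `e + 1 ≥ 10`, and `(e + 1) ^ 2 ≥ 10 * (e + 1) > 2 * n`. -/
theorem five_mul_le (hn : 49 ≤ n) (he : (e + 1) ^ 2 ≤ 2 * (n : ℤ)) : 5 * (e + 1) ≤ n := by
  by_contra! hlt
  have h1 : (49 : ℤ) ≤ n := by exact_mod_cast hn
  have h2 : 10 ≤ e + 1 := by omega
  nlinarith

/-- Three pairwise intersecting neighbours of a block of deficit two have large deficits. -/
theorem add_deficits_le_of_claw (hb : Fintype.card β = n ^ 2 + n + 1)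
    (h : IsRegularLinearSpace n I) (hB : deficit n I B = 2) {C₁ C₂ C₃ : β}
    (h1 : C₁ ∈ nbrs I B) (h2 : C₂ ∈ nbrs I B) (h3 : C₃ ∈ nbrs I B)
    (h12 : C₁ ≠ C₂) (h13 : C₁ ≠ C₃) (h23 : C₂ ≠ C₃)
    (a12 : C₁ ∉ nbrs I C₂) (a13 : C₁ ∉ nbrs I C₃) (a23 : C₂ ∉ nbrs I C₃) :
    n + deficit n I C₁ + deficit n I C₂ + deficit n I C₃
      ≤ deficit n I C₁ * deficit n I C₂ + deficit n I C₁ * deficit n I C₃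
        + deficit n I C₂ * deficit n I C₃ := by
  have hT : ∀ C ∈ nbrs I B, ((nbrs I B ∩ nbrs I C).card : ℤ) = n + deficit n I C - 2 := by
    intro C hC
    rw [card_nbrs_inter_nbrs hb h (mem_nbrs.1 hC).1, if_pos hC, hB]; ring
  have hTT : ∀ C ∈ nbrs I B, ∀ D ∈ nbrs I B, C ≠ D → C ∉ nbrs I D →
      (((nbrs I B ∩ nbrs I C) ∩ (nbrs I B ∩ nbrs I D)).card : ℤ)
        ≤ deficit n I C * deficit n I D - 1 := by
    intro C hC D hD hne hCD
    have h0 := card_nbrs_inter_nbrs hb h hne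
    rw [if_neg hCD] at h0
    have hBm : B ∈ nbrs I D ∩ nbrs I C :=
      mem_inter.2 ⟨mem_nbrs_comm.1 hD, mem_nbrs_comm.1 hC⟩
    have hsub : (nbrs I B ∩ nbrs I C) ∩ (nbrs I B ∩ nbrs I D) ⊆ (nbrs I D ∩ nbrs I C).erase B := by
      intro x hx
      simp only [mem_inter] at hx
      refine mem_erase.2 ⟨?_, mem_inter.2 ⟨hx.2.2, hx.1.2⟩⟩
      rintro rfl; exact notMem_nbrs_self hx.1.1
    have hle := card_le_card hsub
    rw [card_erase_of_mem hBm] at hle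
    have hpos := card_pos.2 ⟨B, hBm⟩
    have : ((nbrs I D ∩ nbrs I C).card : ℤ) - 1
        ≥ ((nbrs I B ∩ nbrs I C) ∩ (nbrs I B ∩ nbrs I D)).card := by omega
    linarith [mul_comm (deficit n I C) (deficit n I D)]
  set S₁ := nbrs I B ∩ nbrs I C₁
  set S₂ := nbrs I B ∩ nbrs I C₂
  set S₃ := nbrs I B ∩ nbrs I C₃
  -- Inclusion–exclusion inside the `2 * n` neighbours of `B`. The union avoids the three `Cᵢ`; each
  -- overlap is smaller than `dᵢ * dⱼ` because `B` is a common neighbour outside it.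
  have hsub : S₁ ∪ S₂ ∪ S₃ ⊆ nbrs I B \ {C₁, C₂, C₃} := by
    have a21 := mt mem_nbrs_comm.1 a12
    have a31 := mt mem_nbrs_comm.1 a13
    have a32 := mt mem_nbrs_comm.1 a23
    have s : ∀ C : β, C ∉ nbrs I C := fun C => notMem_nbrs_self
    intro x hx
    simp only [S₁, S₂, S₃, mem_union, mem_inter] at hx
    simp only [mem_sdiff, mem_insert, mem_singleton, not_or]
    refine ⟨by tauto, ?_, ?_, ?_⟩ <;> rintro rfl <;>
      rcases hx with (hx | hx) | hx <;> first | exact s _ hx.2 | (exact absurd hx.2 ‹_›)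
  have hle := card_le_card hsub
  have h3c : ({C₁, C₂, C₃} : Finset β).card = 3 := by
    rw [card_insert_of_notMem, card_insert_of_notMem, card_singleton] <;> simp [*]
  have h3s : ({C₁, C₂, C₃} : Finset β) ⊆ nbrs I B := by
    intro x; simp only [mem_insert, mem_singleton]; rintro (rfl | rfl | rfl) <;> assumption
  rw [card_sdiff_of_subset h3s, h3c] at hle
  have hge := card_le_card h3s
  have hN := card_nbrs hb h B
  have u1 := card_union_add_card_inter (S₁ ∪ S₂) S₃
  have u2 := card_union_add_card_inter S₁ S₂
  have u3 : ((S₁ ∪ S₂) ∩ S₃).card ≤ (S₁ ∩ S₃).card + (S₂ ∩ S₃).card := by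
    rw [union_inter_distrib_right]; exact card_union_le _ _
  have t1 := hT C₁ h1
  have t2 := hT C₂ h2
  have t3 := hT C₃ h3
  have q12 := hTT C₁ h1 C₂ h2 h12 a12
  have q13 := hTT C₁ h1 C₃ h3 h13 a13
  have q23 := hTT C₂ h2 C₃ h3 h23 a23
  rw [hB] at hN
  rw [h3c] at hge
  zify [hge] at hle u1 u2 u3
  linarith

/-- Two intersecting members of the core would form with `C₂` a claw of deficits two, forcing `n + 6
≤ 12`. -/
theorem mem_nbrs_of_mem_core (hb : Fintype.card β = n ^ 2 + n + 1)
    (h : IsRegularLinearSpace n I) (hB : deficit n I B = 2) (hn : 49 ≤ n)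
    {C₁ C₂ : β} (h2 : C₂ ∈ nbrs I B) (d2 : deficit n I C₂ = 2) {C D : β}
    (hC : C ∈ core n I B C₁ C₂) (hD : D ∈ core n I B C₁ C₂) (hCD : C ≠ D) : C ∈ nbrs I D := by
  simp only [core, mem_filter] at hC hD
  by_contra hna
  have := add_deficits_le_of_claw hb h hB hC.1 hD.1 h2 hCD hC.2.2.2.1 hD.2.2.2.1 hna
    hC.2.2.2.2 hD.2.2.2.2
  rw [hC.2.1, hD.2.1, d2] at this
  omega

theorem card_filter_ne_two_le [Fintype V] (hb : Fintype.card β = n ^ 2 + n + 1)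
    (h : IsRegularLinearSpace n I) (hv : (Fintype.card V : ℤ) = n ^ 2 - e)
    (hB : deficit n I B = 2) (hN : ∀ C ∈ nbrs I B, 2 ≤ deficit n I C) :
    (((nbrs I B).filter fun C => deficit n I C ≠ 2).card : ℤ) ≤ 2 * (e - 1) := by
  have h1 := sum_deficit_nbrs hb h hv B
  rw [hB] at h1
  have h2 : (((nbrs I B).filter fun C => deficit n I C ≠ 2).card : ℤ)
      ≤ ∑ C ∈ nbrs I B, (deficit n I C - 2) := by
    rw [card_filter]; push_cast
    apply sum_le_sum
    intro C hC
    have := hN C hC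
    split_ifs <;> omega
  linarith

/-- Of the `n` common neighbours of `B` and `C₁`, drop the three adjacent to `C₂` and at most `2 *
(e - 1)` of deficit other than two; then add `C₁` itself. -/
theorem le_card_core [Fintype V] (hb : Fintype.card β = n ^ 2 + n + 1)
    (h : IsRegularLinearSpace n I) (hv : (Fintype.card V : ℤ) = n ^ 2 - e)
    (hB : deficit n I B = 2) (hN : ∀ C ∈ nbrs I B, 2 ≤ deficit n I C)
    {C₁ C₂ : β} (h1 : C₁ ∈ nbrs I B) (d1 : deficit n I C₁ = 2)
    (h2 : C₂ ∈ nbrs I B) (d2 : deficit n I C₂ = 2) (h12 : C₁ ≠ C₂) (a12 : C₁ ∉ nbrs I C₂) :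
    (n : ℤ) - 2 * e ≤ (core n I B C₁ C₂).card := by
  set S := nbrs I B ∩ nbrs I C₁
  set Q := (nbrs I C₂ ∩ nbrs I C₁).erase B
  set R := (nbrs I B).filter fun C => deficit n I C ≠ 2
  have hS : (S.card : ℤ) = n := by
    rw [card_nbrs_inter_nbrs hb h (mem_nbrs.1 h1).1, if_pos h1, hB, d1]; ring
  have hQ : (Q.card : ℤ) = 3 := by
    have hBm : B ∈ nbrs I C₂ ∩ nbrs I C₁ :=
      mem_inter.2 ⟨mem_nbrs_comm.1 h2, mem_nbrs_comm.1 h1⟩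
    have h0 := card_nbrs_inter_nbrs hb h h12
    rw [if_neg a12, d1, d2] at h0
    rw [card_erase_of_mem hBm]; omega
  have hR := card_filter_ne_two_le hb h hv hB hN
  have hC1 : C₁ ∉ (S \ Q) \ R := by
    simp [S, notMem_nbrs_self]
  have hsub : insert C₁ ((S \ Q) \ R) ⊆ core n I B C₁ C₂ := by
    intro C hC
    rw [mem_insert] at hC
    simp only [core, mem_filter]
    rcases hC with rfl | hC
    · exact ⟨h1, d1, Or.inl rfl, h12, a12⟩
    · simp only [S, Q, R, mem_sdiff, mem_inter, mem_erase, mem_filter, not_and, not_not] at hC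
      refine ⟨hC.1.1.1, hC.2 hC.1.1.1, Or.inr hC.1.1.2, ?_, fun hC2 => ?_⟩
      · rintro rfl; exact a12 (mem_nbrs_comm.1 hC.1.1.2)
      · refine hC.1.2 ?_ hC2 hC.1.1.2
        rintro rfl; exact notMem_nbrs_self hC.1.1.1
  have c1 := card_le_card hsub
  rw [card_insert_of_notMem hC1] at c1
  have c2 := le_card_sdiff R (S \ Q)
  have c3 := le_card_sdiff Q S
  change ((R.card : ℤ)) ≤ _ at hR
  omega

/-- If `D` misses `E` in the first core and `E'` in the second, in the sense of non-adjacency, then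
at most `2 * (e + 1)` members of the second core are adjacent to `D` and at most four to `E`. Some
other member `F` makes `F`, `E`, `D` a claw, which forces `n ≤ 3 * (e + 1)`. -/
theorem mem_side_or_mem_side [Fintype V] (hb : Fintype.card β = n ^ 2 + n + 1)
    (h : IsRegularLinearSpace n I) (hv : (Fintype.card V : ℤ) = n ^ 2 - e)
    (hB : deficit n I B = 2) (hN : ∀ C ∈ nbrs I B, 2 ≤ deficit n I C ∧ deficit n I C ≤ e + 1)
    (hn : 49 ≤ n) (he : (e + 1) ^ 2 ≤ 2 * (n : ℤ))
    {C₁ C₂ : β} (h1 : C₁ ∈ nbrs I B) (d1 : deficit n I C₁ = 2)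
    (h2 : C₂ ∈ nbrs I B) (d2 : deficit n I C₂ = 2) (h12 : C₁ ≠ C₂) (a12 : C₁ ∉ nbrs I C₂)
    {D : β} (hD : D ∈ nbrs I B) :
    D ∈ side I B (core n I B C₁ C₂) ∨ D ∈ side I B (core n I B C₂ C₁) := by
  by_contra hcon
  simp only [side, mem_filter, hD, true_and, not_or, not_forall] at hcon
  obtain ⟨⟨E, hE, hED, hEa⟩, ⟨E', hE', hED', hEa'⟩⟩ := hcon
  have a21 := mt mem_nbrs_comm.1 a12
  have hcard := le_card_core hb h hv hB (fun C hC => (hN C hC).1) h2 d2 h1 d1 h12.symm a21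
  have h5 := five_mul_le hn he
  have hE0 := mem_filter.1 hE
  have hE0' := mem_filter.1 hE'
  have hDN := hN D hD
  have hclq : ∀ {F G}, F ∈ core n I B C₂ C₁ → G ∈ core n I B C₂ C₁ → F ≠ G → F ∈ nbrs I G :=
    fun hF hG => mem_nbrs_of_mem_core hb h hB hn h1 d1 hF hG
  have hC2 : C₂ ∈ core n I B C₂ C₁ :=
    mem_filter.2 ⟨h2, d2, Or.inl rfl, h12.symm, a21⟩
  have s1 : (core n I B C₂ C₁).filter (· ∈ nbrs I D) ⊆ nbrs I E' ∩ nbrs I D := by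
    intro F hF
    rw [mem_filter] at hF
    refine mem_inter.2 ⟨hclq hF.1 hE' ?_, hF.2⟩
    rintro rfl; exact hEa' hF.2
  have s2 : (core n I B C₂ C₁).filter (· ∈ nbrs I E) ⊆ nbrs I C₂ ∩ nbrs I E := by
    intro F hF
    rw [mem_filter] at hF
    refine mem_inter.2 ⟨hclq hF.1 hC2 ?_, hF.2⟩
    rintro rfl; exact hE0.2.2.2.2 (mem_nbrs_comm.1 hF.2)
  have c1 := card_le_card s1
  have c2 := card_le_card s2
  have m1 := card_nbrs_inter_nbrs hb h (B := E') (B' := D) (Ne.symm hED')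
  rw [if_neg (mt mem_nbrs_comm.1 hEa'), hE0'.2.1] at m1
  have m2 := card_nbrs_inter_nbrs hb h (B := C₂) (B' := E) hE0.2.2.2.1
  rw [if_neg hE0.2.2.2.2, hE0.2.1, d2] at m2
  have : ∃ F ∈ core n I B C₂ C₁, F ∉ (core n I B C₂ C₁).filter (· ∈ nbrs I D)
      ∪ (core n I B C₂ C₁).filter (· ∈ nbrs I E) ∪ {D} := by
    by_contra! hall
    have c3 := card_le_card hall
    have c4 := card_union_le ((core n I B C₂ C₁).filter (· ∈ nbrs I D)
      ∪ (core n I B C₂ C₁).filter (· ∈ nbrs I E)) {D}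
    have c5 := card_union_le ((core n I B C₂ C₁).filter (· ∈ nbrs I D))
      ((core n I B C₂ C₁).filter (· ∈ nbrs I E))
    rw [card_singleton] at c4
    omega
  obtain ⟨F, hF, hFn⟩ := this
  simp only [mem_union, mem_filter, hF, true_and, mem_singleton, not_or] at hFn
  have hF0 := mem_filter.1 hF
  have hFE : F ≠ E := by
    rintro rfl
    rcases hE0.2.2.1 with h0 | h0
    · exact hF0.2.2.2.1 h0
    · exact hF0.2.2.2.2 h0
  have := add_deficits_le_of_claw hb h hB hF0.1 hE0.1 hD hFE hFn.2 hED hFn.1.2 hFn.1.1 hEa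
  rw [hF0.2.1, hE0.2.1] at this
  omega

/-- A common member would have about `2 * (n - 2 * e)` common neighbours with `B`, against at most
`n + e - 1`. The bound `5 * (e + 1) ≤ n` excludes this. -/
theorem disjoint_side [Fintype V] (hb : Fintype.card β = n ^ 2 + n + 1)
    (h : IsRegularLinearSpace n I) (hv : (Fintype.card V : ℤ) = n ^ 2 - e)
    (hB : deficit n I B = 2) (hN : ∀ C ∈ nbrs I B, 2 ≤ deficit n I C ∧ deficit n I C ≤ e + 1)
    (hn : 49 ≤ n) (he : (e + 1) ^ 2 ≤ 2 * (n : ℤ))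
    {C₁ C₂ : β} (h1 : C₁ ∈ nbrs I B) (d1 : deficit n I C₁ = 2)
    (h2 : C₂ ∈ nbrs I B) (d2 : deficit n I C₂ = 2) (h12 : C₁ ≠ C₂) (a12 : C₁ ∉ nbrs I C₂) :
    Disjoint (side I B (core n I B C₁ C₂)) (side I B (core n I B C₂ C₁)) := by
  rw [disjoint_left]
  intro D hD hD'
  simp only [side, mem_filter] at hD hD'
  have a21 := mt mem_nbrs_comm.1 a12
  have hc1 := le_card_core hb h hv hB (fun C hC => (hN C hC).1) h1 d1 h2 d2 h12 a12
  have hc2 := le_card_core hb h hv hB (fun C hC => (hN C hC).1) h2 d2 h1 d1 h12.symm a21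
  have h5 := five_mul_le hn he
  have hDN := hN D hD.1
  have hdis : Disjoint (core n I B C₁ C₂) (core n I B C₂ C₁) := by
    rw [disjoint_left]
    intro E hE hE'
    have hE0 := (mem_filter.1 hE).2
    have hE0' := (mem_filter.1 hE').2
    rcases hE0.2.1 with h0 | h0
    · exact hE0'.2.2.1 h0
    · exact hE0'.2.2.2 h0
  have hsub : (core n I B C₁ C₂ ∪ core n I B C₂ C₁).erase D ⊆ nbrs I B ∩ nbrs I D := by
    intro E hE
    rw [mem_erase, mem_union] at hE
    rcases hE.2 with h0 | h0
    · exact mem_inter.2 ⟨(mem_filter.1 h0).1, (hD.2 E h0).resolve_left hE.1⟩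
    · exact mem_inter.2 ⟨(mem_filter.1 h0).1, (hD'.2 E h0).resolve_left hE.1⟩
  have c1 := card_le_card hsub
  have c2 := pred_card_le_card_erase (s := core n I B C₁ C₂ ∪ core n I B C₂ C₁) (a := D)
  rw [card_union_of_disjoint hdis] at c2
  have m1 := card_nbrs_inter_nbrs hb h (mem_nbrs.1 hD.1).1
  rw [if_pos hD.1, hB] at m1
  omega

/-- Intersecting `D` and `E` have the core and `B` as common neighbours, so the product of their
deficits is at least `n - 2 * e + 1`, which exceeds `3 * (e + 1)`. -/
theorem four_le_deficit_of_mem_side [Fintype V] (hb : Fintype.card β = n ^ 2 + n + 1)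
    (h : IsRegularLinearSpace n I) (hv : (Fintype.card V : ℤ) = n ^ 2 - e)
    (hB : deficit n I B = 2) (hN : ∀ C ∈ nbrs I B, 2 ≤ deficit n I C ∧ deficit n I C ≤ e + 1)
    (hn : 49 ≤ n) (he : (e + 1) ^ 2 ≤ 2 * (n : ℤ))
    {C₁ C₂ : β} (h1 : C₁ ∈ nbrs I B) (d1 : deficit n I C₁ = 2)
    (h2 : C₂ ∈ nbrs I B) (d2 : deficit n I C₂ = 2) (h12 : C₁ ≠ C₂) (a12 : C₁ ∉ nbrs I C₂)
    {D E : β} (hD : D ∈ side I B (core n I B C₁ C₂)) (hE : E ∈ side I B (core n I B C₁ C₂))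
    (hDE : D ≠ E) (hna : D ∉ nbrs I E) : 4 ≤ deficit n I D := by
  simp only [side, mem_filter] at hD hE
  have hc1 := le_card_core hb h hv hB (fun C hC => (hN C hC).1) h1 d1 h2 d2 h12 a12
  have h5 := five_mul_le hn he
  have hsub : insert B (core n I B C₁ C₂) ⊆ nbrs I E ∩ nbrs I D := by
    intro F hF
    rw [mem_insert] at hF
    rcases hF with rfl | hF
    · exact mem_inter.2 ⟨mem_nbrs_comm.1 hE.1, mem_nbrs_comm.1 hD.1⟩
    · refine mem_inter.2 ⟨(hE.2 F hF).resolve_left ?_, (hD.2 F hF).resolve_left ?_⟩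
      · rintro rfl
        exact (hD.2 F hF).elim (fun h0 => hDE h0.symm) (fun h0 => hna (mem_nbrs_comm.1 h0))
      · rintro rfl
        exact (hE.2 F hF).elim hDE hna
  have hBn : B ∉ core n I B C₁ C₂ := fun h0 => notMem_nbrs_self (mem_filter.1 h0).1
  have c1 := card_le_card hsub
  rw [card_insert_of_notMem hBn] at c1
  have m1 := card_nbrs_inter_nbrs hb h hDE
  rw [if_neg hna] at m1
  have e1 := hN E hE.1
  have e2 := hN D hD.1
  by_contra! hlt
  have : deficit n I E * deficit n I D ≤ (e + 1) * 3 := by nlinarith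
  omega

end Cliques
-- From near-cliques to parallel classes
section Split

variable {V β : Type*} {n : ℕ} {I : β → Finset V} {e : ℤ} {B : β}

theorem two_mul_card_filter_le {X : Finset β} (hN : ∀ C ∈ X, 2 ≤ deficit n I C) :
    2 * ((X.filter fun C => 4 ≤ deficit n I C).card : ℤ) ≤ ∑ C ∈ X, (deficit n I C - 2) := by
  rw [card_filter]; push_cast; rw [mul_sum]
  apply sum_le_sum
  intro C hC
  have := hN C hC
  split_ifs <;> omega

theorem sum_card_eq_sub {X : Finset β} :
    ∑ C ∈ X, ((I C).card : ℤ) = (n - 1) * X.card - ∑ C ∈ X, (deficit n I C - 2) := by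
  simp only [deficit, sum_sub_distrib, sum_const, nsmul_eq_mul]; ring

theorem card_compl_block [Fintype V] [DecidableEq V] (hv : (Fintype.card V : ℤ) = n ^ 2 - e) (hB : deficit n I B = 2) :
    (((I B)ᶜ).card : ℤ) = n ^ 2 - e - n + 1 := by
  have h1 := card_add_card_compl (I B)
  zify at h1
  simp only [deficit] at hB
  linarith

variable [DecidableEq V] [Fintype β] [DecidableEq β]

theorem isParallelClass_insert {X : Finset β} (hXB : X ⊆ nbrs I B) (hcard : X.card = n)
    (hX : ∀ y ∉ I B, (X.filter fun C => y ∈ I C).card = 1) :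
    IsParallelClass n I (insert B X) := by
  refine ⟨by rw [card_insert_of_notMem fun h0 => notMem_nbrs_self (hXB h0), hcard], fun y => ?_⟩
  by_cases hy : y ∈ I B
  · refine ⟨B, ⟨mem_insert_self _ _, hy⟩, ?_⟩
    rintro C ⟨hC, hyC⟩
    refine (mem_insert.1 hC).resolve_right fun h0 => ?_
    exact disjoint_left.1 (mem_nbrs.1 (hXB h0)).2 hy hyC
  · obtain ⟨C, hC⟩ := card_eq_one.1 (hX y hy)
    have hm : ∀ D, D ∈ X ∧ y ∈ I D ↔ D = C := by
      intro D; rw [← mem_filter (p := fun C => y ∈ I C), hC, mem_singleton]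
    refine ⟨C, ⟨mem_insert_of_mem ((hm C).2 rfl).1, ((hm C).2 rfl).2⟩, ?_⟩
    rintro D ⟨hD, hyD⟩
    rcases mem_insert.1 hD with rfl | hD
    · exact absurd hyD hy
    · exact (hm D).1 ⟨hD, hyD⟩

theorem card_filter_add_card_filter (h : IsRegularLinearSpace n I) (hB : deficit n I B = 2)
    {X X' : Finset β} (hX : X ∪ X' = nbrs I B) (hd : Disjoint X X') {y : V} (hy : y ∉ I B) :
    (X.filter fun C => y ∈ I C).card + (X'.filter fun C => y ∈ I C).card = 2 := by
  have h1 := card_filter_mem_nbrs h hy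
  rw [hB, ← hX, filter_union, card_union_of_disjoint (disjoint_filter_filter hd)] at h1
  exact_mod_cast h1

/-- A block of deficit one is in a parallel class. -/
theorem isParallelClass_of_deficit_eq_one (hb : Fintype.card β = n ^ 2 + n + 1)
    (h : IsRegularLinearSpace n I) (hB : deficit n I B = 1) :
    IsParallelClass n I (insert B (nbrs I B)) := by
  apply isParallelClass_insert Subset.rfl
  · have := card_nbrs hb h B
    rw [hB] at this; omega
  · intro y hy
    have := card_filter_mem_nbrs h hy
    rw [hB] at this; exact_mod_cast this

variable [Fintype V]

/-- A point outside `B` is on two neighbours of `B`, so a point doubly covered by `X` is uncovered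
by `X'`, and conversely. -/
theorem sum_card_add_card_doublePoints (h : IsRegularLinearSpace n I)
    (hB : deficit n I B = 2) {X X' : Finset β} (hX : X ∪ X' = nbrs I B) (hd : Disjoint X X') :
    ∑ C ∈ X, ((I C).card : ℤ) + (doublePoints I B X').card
      = ((I B)ᶜ).card + (doublePoints I B X).card := by
  have h1 : ∑ C ∈ X, ((I C).card : ℤ) = ∑ y ∈ (I B)ᶜ, ((X.filter fun C => y ∈ I C).card : ℤ) := by
    simp_rw [card_filter]
    push_cast
    rw [sum_comm]
    apply sum_congr rfl
    intro C hC
    have hC' : C ∈ nbrs I B := by rw [← hX]; exact mem_union_left _ hC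
    rw [← sum_filter, sum_const, nsmul_eq_mul, mul_one]
    congr 2
    ext y
    simp only [mem_filter, mem_compl]
    exact ⟨fun hy => ⟨fun hyB => disjoint_left.1 (mem_nbrs.1 hC').2 hyB hy, hy⟩, fun hy => hy.2⟩
  rw [h1, doublePoints, doublePoints, card_filter, card_filter, card_eq_sum_ones]
  push_cast
  rw [← sum_add_distrib, ← sum_add_distrib]
  apply sum_congr rfl
  intro y hy
  have := card_filter_add_card_filter h hB hX hd (mem_compl.1 hy)
  split_ifs <;> omega

/-- Distinct double points determine distinct pairs of intersecting blocks, all of deficit at least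
four. -/
theorem two_mul_card_doublePoints_le (h : IsRegularLinearSpace n I) {X : Finset β}
    (h4 : ∀ D ∈ X, ∀ E ∈ X, D ≠ E → D ∉ nbrs I E → 4 ≤ deficit n I D) :
    2 * ((doublePoints I B X).card : ℤ)
      ≤ (X.filter fun C => 4 ≤ deficit n I C).card
        * ((X.filter fun C => 4 ≤ deficit n I C).card - 1) := by
  set H := X.filter fun C => 4 ≤ deficit n I C
  have hle : (doublePoints I B X).card ≤ (H.powersetCard 2).card := by
    apply card_le_card_of_injOn fun y => X.filter fun C => y ∈ I C
    · intro y hy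
      have hy2 := (mem_filter.1 hy).2
      refine mem_powersetCard.2 ⟨?_, hy2⟩
      intro C hC
      obtain ⟨D, hD, hDC⟩ := exists_mem_ne (by rw [hy2]; norm_num) C
      rw [mem_filter] at hC hD
      refine mem_filter.2 ⟨hC.1, h4 C hC.1 D hD.1 hDC.symm fun hCD => ?_⟩
      exact disjoint_left.1 (mem_nbrs.1 hCD).2 hD.2 hC.2
    · intro y hy z hz hyz
      have hy2 := (mem_filter.1 hy).2
      obtain ⟨C, D, hCD, hCDe⟩ := card_eq_two.1 hy2
      have hyz' : (X.filter fun C => y ∈ I C) = X.filter fun C => z ∈ I C := hyz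
      have hC : C ∈ X.filter fun C => y ∈ I C := by rw [hCDe]; simp
      have hD : D ∈ X.filter fun C => y ∈ I C := by rw [hCDe]; simp
      have hC' := hC
      have hD' := hD
      rw [hyz'] at hC' hD'
      rw [mem_filter] at hC hD hC' hD'
      exact eq_of_mem_of_mem h hCD hD.2 hC.2 hD'.2 hC'.2
  rw [card_powersetCard, Nat.choose_two_right] at hle
  have h1 : 2 * (H.card * (H.card - 1) / 2) ≤ H.card * (H.card - 1) := Nat.mul_div_le _ 2
  have h2 : 2 * (doublePoints I B X).card ≤ H.card * (H.card - 1) := by omega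
  rcases Nat.eq_zero_or_pos H.card with h0 | h0
  · rw [h0] at h2 ⊢; push_cast; omega
  · zify [h0] at h2; exact h2

/-- With `n + 1` blocks or more, `X` would cover so much that there are more double points than the
`(e - 1) * (e - 2) / 2` available pairs. -/
theorem card_le_of_split (h : IsRegularLinearSpace n I)
    (hv : (Fintype.card V : ℤ) = n ^ 2 - e) (hB : deficit n I B = 2)
    (hn : 49 ≤ n) (he : (e + 1) ^ 2 ≤ 2 * (n : ℤ))
    {X X' : Finset β} (hX : X ∪ X' = nbrs I B) (hd : Disjoint X X')
    (hN : ∀ C ∈ X, 2 ≤ deficit n I C)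
    (hexc : ∑ C ∈ X, (deficit n I C - 2) ≤ 2 * (e - 1))
    (h4 : ∀ D ∈ X, ∀ E ∈ X, D ≠ E → D ∉ nbrs I E → 4 ≤ deficit n I D) : X.card ≤ n := by
  by_contra! hlt
  have h1 := sum_card_add_card_doublePoints h hB hX hd
  have h2 := two_mul_card_doublePoints_le (B := B) h h4
  have h3 := two_mul_card_filter_le hN
  have h0 : (0 : ℤ) ≤ ∑ C ∈ X, (deficit n I C - 2) :=
    sum_nonneg fun C hC => by have := hN C hC; omega
  rw [card_compl_block hv hB, sum_card_eq_sub (n := n)] at h1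
  set H := X.filter fun C => 4 ≤ deficit n I C
  have hlt' : (n : ℤ) + 1 ≤ X.card := by exact_mod_cast hlt
  have hn' : (49 : ℤ) ≤ n := by exact_mod_cast hn
  have h5 : (H.card : ℤ) ≤ e - 1 := by linarith
  have h6 : (H.card : ℤ) * (H.card - 1) ≤ (e - 1) * (e - 2) := by
    rcases Nat.eq_zero_or_pos H.card with hz | hz
    · rw [hz]; push_cast; nlinarith
    · have : (1 : ℤ) ≤ H.card := by exact_mod_cast hz
      nlinarith
  have h7 : ((n : ℤ) - 1) * (n + 1) ≤ (n - 1) * X.card :=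
    mul_le_mul_of_nonneg_left hlt' (by linarith)
  nlinarith

/-- Two blocks `C`, `D` of `X` on a double point are adjacent to `B` and to all of `X` of deficit
below four, so their deficits have product at least `n + 2 - e`. An excess below `e` bounds their
sum by `e + 3`, and AM–GM gives a contradiction. -/
theorem le_sum_of_doublePoints_nonempty (hb : Fintype.card β = n ^ 2 + n + 1)
    (h : IsRegularLinearSpace n I) (hn : 49 ≤ n) (he : (e + 1) ^ 2 ≤ 2 * (n : ℤ))
    {X : Finset β} (hXB : X ⊆ nbrs I B) (hN : ∀ C ∈ X, 2 ≤ deficit n I C)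
    (hexc : ∑ C ∈ X, (deficit n I C - 2) ≤ 2 * (e - 1)) (hcard : X.card = n)
    (h4 : ∀ D ∈ X, ∀ E ∈ X, D ≠ E → D ∉ nbrs I E → 4 ≤ deficit n I D)
    (hW : (doublePoints I B X).Nonempty) : e ≤ ∑ C ∈ X, (deficit n I C - 2) := by
  obtain ⟨y, hy⟩ := hW
  obtain ⟨C, D, hCD, hCDe⟩ := card_eq_two.1 (mem_filter.1 hy).2
  have hC : C ∈ X.filter fun C => y ∈ I C := by rw [hCDe]; simp
  have hD : D ∈ X.filter fun C => y ∈ I C := by rw [hCDe]; simp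
  rw [mem_filter] at hC hD
  have hna : C ∉ nbrs I D := fun hCD' => disjoint_left.1 (mem_nbrs.1 hCD').2 hD.2 hC.2
  have h3 := two_mul_card_filter_le hN
  have hsum : deficit n I C - 2 + (deficit n I D - 2) ≤ ∑ C ∈ X, (deficit n I C - 2) := by
    rw [← sum_pair (f := fun C => deficit n I C - 2) hCD]
    apply sum_le_sum_of_subset_of_nonneg
    · intro E; simp only [mem_insert, mem_singleton]; rintro (rfl | rfl)
      exacts [hC.1, hD.1]
    · intro E hE _; have := hN E hE; omega
  have h4C := h4 C hC.1 D hD.1 hCD hna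
  have h4D := h4 D hD.1 C hC.1 hCD.symm (mt mem_nbrs_comm.1 hna)
  set H := X.filter fun C => 4 ≤ deficit n I C
  have hsub : insert B (X \ H) ⊆ nbrs I D ∩ nbrs I C := by
    intro F hF
    rw [mem_insert, mem_sdiff] at hF
    rcases hF with rfl | hF
    · exact mem_inter.2 ⟨mem_nbrs_comm.1 (hXB hD.1), mem_nbrs_comm.1 (hXB hC.1)⟩
    · have hF4 : deficit n I F < 4 := by
        by_contra! h0; exact hF.2 (mem_filter.2 ⟨hF.1, h0⟩)
      refine mem_inter.2 ⟨?_, ?_⟩ <;> by_contra h0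
      · have := h4 F hF.1 D hD.1 (by rintro rfl; omega) h0; omega
      · have := h4 F hF.1 C hC.1 (by rintro rfl; omega) h0; omega
  have hBn : B ∉ X \ H := fun h0 => notMem_nbrs_self (hXB (mem_sdiff.1 h0).1)
  have c1 := card_le_card hsub
  rw [card_insert_of_notMem hBn] at c1
  have c2 := le_card_sdiff H X
  have m1 := card_nbrs_inter_nbrs hb h hCD
  rw [if_neg hna] at m1
  have hn' : (49 : ℤ) ≤ n := by exact_mod_cast hn
  have c3 : (n : ℤ) + 2 - e ≤ deficit n I D * deficit n I C := by omega
  by_contra! hlt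
  have hs : deficit n I C + deficit n I D ≤ e + 3 := by linarith
  have hsq : 4 * (deficit n I D * deficit n I C) ≤ (e + 3) ^ 2 := by
    have := pow_le_pow_left₀ (by linarith) hs 2
    linarith [sq_nonneg (deficit n I C - deficit n I D),
      add_sq (deficit n I C) (deficit n I D), sub_sq (deficit n I C) (deficit n I D)]
  clear * - h4C h4D hlt hsum hexc hn' c3 hsq he
  have he3 : 3 ≤ e := by linarith
  rcases le_or_gt e 5 with h5 | h5
  · have := mul_nonneg (sub_nonneg.2 h5) (by linarith : (0 : ℤ) ≤ e + 11)
    linarith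
  · have := mul_nonneg (by linarith : 0 ≤ e) (by linarith : 0 ≤ e - 6)
    linarith

/-- Each of the `n - 1` points of `C₁` is on a second neighbour of `B`. These are distinct, and too
many to all have deficit other than two. -/
theorem exists_block_pair (hb : Fintype.card β = n ^ 2 + n + 1)
    (h : IsRegularLinearSpace n I) (hv : (Fintype.card V : ℤ) = n ^ 2 - e)
    (hB : deficit n I B = 2) (hN : ∀ C ∈ nbrs I B, 2 ≤ deficit n I C)
    (hn : 49 ≤ n) (he : (e + 1) ^ 2 ≤ 2 * (n : ℤ)) :
    ∃ C₁ ∈ nbrs I B, ∃ C₂ ∈ nbrs I B, deficit n I C₁ = 2 ∧ deficit n I C₂ = 2 ∧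
      C₁ ≠ C₂ ∧ C₁ ∉ nbrs I C₂ := by
  have h5 := five_mul_le hn he
  have hR := card_filter_ne_two_le hb h hv hB hN
  have hc := card_nbrs hb h B
  rw [hB] at hc
  set R := (nbrs I B).filter fun C => deficit n I C ≠ 2
  have two_of : ∀ {C}, C ∈ nbrs I B → C ∉ R → deficit n I C = 2 := by
    intro C hC hCR
    by_contra h0; exact hCR (mem_filter.2 ⟨hC, h0⟩)
  obtain ⟨C₁, h1, h1R⟩ : ∃ C ∈ nbrs I B, C ∉ R := by
    by_contra! hall
    have := card_le_card hall
    omega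
  have d1 := two_of h1 h1R
  have hex : ∀ y ∈ I C₁, ∃ C ∈ nbrs I B, y ∈ I C ∧ C ≠ C₁ := by
    intro y hy
    have hyB : y ∉ I B := fun hyB => disjoint_left.1 (mem_nbrs.1 h1).2 hyB hy
    have h2 := card_filter_mem_nbrs h hyB
    rw [hB] at h2
    obtain ⟨C, hC, hne⟩ := exists_mem_ne (s := (nbrs I B).filter fun C => y ∈ I C)
      (by omega) C₁
    rw [mem_filter] at hC
    exact ⟨C, hC.1, hC.2, hne⟩
  have : Nonempty β := ⟨B⟩
  choose! g hg using hex
  have hinj : Set.InjOn g (I C₁) := by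
    intro y hy z hz hyz
    have hz2 := (hg z hz).2.1
    rw [← hyz] at hz2
    exact eq_of_mem_of_mem h (hg y hy).2.2 hy (hg y hy).2.1 hz hz2
  obtain ⟨y, hy, hyR⟩ : ∃ y ∈ I C₁, g y ∉ R := by
    by_contra! hall
    have := card_le_card_of_injOn g hall hinj
    simp only [deficit] at d1
    omega
  refine ⟨C₁, h1, g y, (hg y hy).1, d1, two_of (hg y hy).1 hyR, (hg y hy).2.2.symm, fun h0 => ?_⟩
  exact disjoint_left.1 (mem_nbrs.1 h0).2 (hg y hy).2.1 hy

/-- If a block of deficit two has only neighbours of moderate deficit, its neighbours come from two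
parallel classes. -/
theorem exists_parallelClass_pair (hb : Fintype.card β = n ^ 2 + n + 1)
    (h : IsRegularLinearSpace n I) (hv : (Fintype.card V : ℤ) = n ^ 2 - e)
    (hB : deficit n I B = 2) (hN : ∀ C ∈ nbrs I B, 2 ≤ deficit n I C ∧ deficit n I C ≤ e + 1)
    (hn : 49 ≤ n) (he : (e + 1) ^ 2 ≤ 2 * (n : ℤ)) :
    ∃ X X' : Finset β, X ∪ X' = nbrs I B ∧
      IsParallelClass n I (insert B X) ∧ IsParallelClass n I (insert B X') := by
  obtain ⟨C₁, h1, C₂, h2, d1, d2, h12, a12⟩ :=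
    exists_block_pair hb h hv hB (fun C hC => (hN C hC).1) hn he
  have a21 := mt mem_nbrs_comm.1 a12
  have hdis := disjoint_side hb h hv hB hN hn he h1 d1 h2 d2 h12 a12
  have hun : side I B (core n I B C₁ C₂) ∪ side I B (core n I B C₂ C₁) = nbrs I B := by
    ext D
    rw [mem_union]
    refine ⟨fun h0 => ?_, fun hD => mem_side_or_mem_side hb h hv hB hN hn he h1 d1 h2 d2 h12 a12 hD⟩
    rcases h0 with h0 | h0 <;> exact (mem_filter.1 h0).1
  have h4 : ∀ D ∈ side I B (core n I B C₁ C₂), ∀ E ∈ side I B (core n I B C₁ C₂),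
      D ≠ E → D ∉ nbrs I E → 4 ≤ deficit n I D := fun D hD E hE =>
    four_le_deficit_of_mem_side hb h hv hB hN hn he h1 d1 h2 d2 h12 a12 hD hE
  have h4' : ∀ D ∈ side I B (core n I B C₂ C₁), ∀ E ∈ side I B (core n I B C₂ C₁),
      D ≠ E → D ∉ nbrs I E → 4 ≤ deficit n I D := fun D hD E hE =>
    four_le_deficit_of_mem_side hb h hv hB hN hn he h2 d2 h1 d1 h12.symm a21 hD hE
  generalize side I B (core n I B C₁ C₂) = X at *
  generalize side I B (core n I B C₂ C₁) = X' at *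
  have hun' : X' ∪ X = nbrs I B := by rw [union_comm, hun]
  have hXB : X ⊆ nbrs I B := by rw [← hun]; exact subset_union_left
  have hXB' : X' ⊆ nbrs I B := by rw [← hun]; exact subset_union_right
  have hNX : ∀ C ∈ X, 2 ≤ deficit n I C := fun C hC => (hN C (hXB hC)).1
  have hNX' : ∀ C ∈ X', 2 ≤ deficit n I C := fun C hC => (hN C (hXB' hC)).1
  have hexc := sum_deficit_nbrs hb h hv B
  rw [hB, ← hun, sum_union hdis] at hexc
  have p : 0 ≤ ∑ C ∈ X, (deficit n I C - 2) :=
    sum_nonneg fun C hC => by have := hNX C hC; omega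
  have p' : 0 ≤ ∑ C ∈ X', (deficit n I C - 2) :=
    sum_nonneg fun C hC => by have := hNX' C hC; omega
  have k := card_le_of_split h hv hB hn he hun hdis hNX (by linarith) h4
  have k' := card_le_of_split h hv hB hn he hun' hdis.symm hNX' (by linarith) h4'
  have hc := card_nbrs hb h B
  rw [hB, ← hun, card_union_of_disjoint hdis] at hc
  have kX : X.card = n := by push_cast at hc; omega
  have kX' : X'.card = n := by push_cast at hc; omega
  have w := sum_card_add_card_doublePoints h hB hun hdis
  have w' := sum_card_add_card_doublePoints h hB hun' hdis.symm
  rw [card_compl_block hv hB, sum_card_eq_sub (n := n), kX] at w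
  rw [card_compl_block hv hB, sum_card_eq_sub (n := n), kX'] at w'
  have l := le_sum_of_doublePoints_nonempty hb h hn he hXB hNX (by linarith) kX h4
  have l' := le_sum_of_doublePoints_nonempty hb h hn he hXB' hNX' (by linarith) kX' h4'
  rw [← card_pos] at l l'
  -- The excesses `s`, `s'` add up to `2 * (e - 1)`, and the double points differ in number by `s -
  -- (e - 1)`. A double point on one side gives excess at least `e` there, hence a double point on
  -- the other side, and a total of at least `2 * e`.
  have w0 : (doublePoints I B X).card = 0 ∧ (doublePoints I B X').card = 0 := by
    have ww : ((doublePoints I B X').card : ℤ) - (doublePoints I B X).card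
        = ∑ C ∈ X, (deficit n I C - 2) - (e - 1) := by linarith
    generalize ∑ C ∈ X, (deficit n I C - 2) = s at *
    generalize ∑ C ∈ X', (deficit n I C - 2) = s' at *
    clear w w'
    constructor
    · by_contra h0
      have := l (by omega)
      have := l' (by omega)
      omega
    · by_contra h0
      have := l' (by omega)
      have := l (by omega)
      omega
  have hone : ∀ y ∉ I B, (X.filter fun C => y ∈ I C).card = 1 ∧
      (X'.filter fun C => y ∈ I C).card = 1 := by
    intro y hy
    have s := card_filter_add_card_filter h hB hun hdis hy
    have u : (X.filter fun C => y ∈ I C).card ≠ 2 := fun h0 =>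
      (card_pos.2 ⟨y, mem_filter.2 ⟨mem_compl.2 hy, h0⟩⟩).ne' w0.1
    have u' : (X'.filter fun C => y ∈ I C).card ≠ 2 := fun h0 =>
      (card_pos.2 ⟨y, mem_filter.2 ⟨mem_compl.2 hy, h0⟩⟩).ne' w0.2
    omega
  exact ⟨X, X', hun, isParallelClass_insert hXB kX fun y hy => (hone y hy).1,
    isParallelClass_insert hXB' kX' fun y hy => (hone y hy).2⟩

end Split
-- Points and parallel classes as blocks
/-- The points and the parallel classes of a set `L` of lines, as sets of lines. -/
def blocks {P K : Type*} [DecidableEq P] [DecidableEq K] (L : Finset (Finset P))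
    (c : Finset P → K) : P ⊕ K → Finset {l // l ∈ L}
  | Sum.inl p => univ.filter fun l => p ∈ l.1
  | Sum.inr i => univ.filter fun l => c l.1 = i

/-- The values of `c` label the parallel classes of `L`. -/
def IsClassMap {P K : Type*} (L : Finset (Finset P)) (c : Finset P → K) : Prop :=
  ∀ l ∈ L, ∀ m ∈ L, c l = c m ↔ Parallel l m

section Blocks

variable {P K : Type*} {n : ℕ} {L : Finset (Finset P)} {c : Finset P → K}

theorem card_filter_sum_type [Fintype P] [Fintype K] (q : P ⊕ K → Prop) [DecidablePred q] :
    (univ.filter q).card = (univ.filter fun p => q (Sum.inl p)).card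
      + (univ.filter fun i => q (Sum.inr i)).card := by
  simp only [card_filter, Fintype.sum_sum_type]

theorem sum_eq_sum_toLeft_add_sum_toRight (Z : Finset (P ⊕ K)) (g : P ⊕ K → ℤ) :
    ∑ C ∈ Z, g C = ∑ p ∈ Z.toLeft, g (Sum.inl p) + ∑ i ∈ Z.toRight, g (Sum.inr i) := by
  conv_lhs => rw [← toLeft_disjSum_toRight (u := Z)]
  rw [sum_disjSum]

variable [DecidableEq P] [DecidableEq K]

theorem mem_blocks_inl {p : P} {l : {l // l ∈ L}} : l ∈ blocks L c (Sum.inl p) ↔ p ∈ l.1 := by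
  simp [blocks]

theorem mem_blocks_inr {i : K} {l : {l // l ∈ L}} : l ∈ blocks L c (Sum.inr i) ↔ c l.1 = i := by
  simp [blocks]

theorem sum_card_blocks_inr [Fintype K] :
    ∑ i, ((blocks L c (Sum.inr i)).card : ℤ) = L.card := by
  have h1 : ∑ i, (blocks L c (Sum.inr i)).card = (univ : Finset {l // l ∈ L}).card :=
    (card_eq_sum_card_fiberwise (f := fun l : {l // l ∈ L} => c l.1)
      (fun _ _ => mem_coe.2 (mem_univ _))).symm
  rw [card_univ, Fintype.card_coe] at h1
  exact_mod_cast h1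

theorem sum_card_blocks_inl [Fintype P] (hL : IsPartialAffinePlane n L) :
    ∑ p, ((blocks L c (Sum.inl p)).card : ℤ) = n * L.card := by
  have h1 : ∑ p, (blocks L c (Sum.inl p)).card = ∑ l : {l // l ∈ L}, l.1.card := by
    simp only [blocks, card_filter]
    rw [sum_comm]
    simp
  have h2 : ∀ l : {l // l ∈ L}, l.1.card = n := fun l => hL.card_line l.1 l.2
  simp only [h2, sum_const, card_univ, Fintype.card_coe, smul_eq_mul] at h1
  have h3 : (∑ p, ((blocks L c (Sum.inl p)).card : ℤ)) = L.card * n := by exact_mod_cast h1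
  rw [h3, mul_comm]

theorem eq_of_mem_blocks (hc : IsClassMap L c) {p : P} {l m : {l // l ∈ L}}
    (hcl : c l.1 = c m.1) (hl : l ∈ blocks L c (Sum.inl p)) (hm : m ∈ blocks L c (Sum.inl p)) :
    l = m := by
  rw [mem_blocks_inl] at hl hm
  rcases (hc l.1 l.2 m.1 m.2).1 hcl with h0 | h0
  · exact Subtype.ext h0
  · exact absurd hm (disjoint_left.1 h0 hl)

variable [Fintype P]

/-- A parallel class of blocks that contains a single class of lines is a new line. -/
theorem exists_insert_of_isParallelClass (hL : IsPartialAffinePlane n L) (hc : IsClassMap L c)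
    {Z : Finset (P ⊕ K)} (hZ : IsParallelClass n (blocks L c) Z) (h1 : Z.toRight.card = 1) :
    ∃ N ∉ L, IsPartialAffinePlane n (insert N L) ∧
      ∃ c' : Finset P → K, IsClassMap (insert N L) c' := by
  obtain ⟨i, hi⟩ := card_eq_one.1 h1
  have hmi : ∀ j, Sum.inr j ∈ Z ↔ j = i := by
    intro j; rw [← mem_toRight, hi, mem_singleton]
  have hN : Z.toLeft.card = n := by
    have h2 := card_toLeft_add_card_toRight (u := Z)
    rw [hZ.card_eq] at h2; omega
  -- Every line is in exactly one block of `Z`: either the class `i` or a single one of its `n`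
  -- points.
  have hpar : ∀ l ∈ L, c l = i → Disjoint Z.toLeft l := by
    intro l hl hli
    rw [disjoint_left]
    intro p hp hpl
    rw [mem_toLeft] at hp
    have := (hZ.existsUnique_mem ⟨l, hl⟩).unique ⟨hp, mem_blocks_inl.2 hpl⟩
      ⟨(hmi i).2 rfl, mem_blocks_inr.2 hli⟩
    cases this
  have hmeet : ∀ l ∈ L, c l ≠ i → (Z.toLeft ∩ l).card = 1 := by
    intro l hl hli
    obtain ⟨C, ⟨hCZ, hlC⟩, hCu⟩ := hZ.existsUnique_mem ⟨l, hl⟩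
    rw [card_eq_one]
    rcases C with p | j
    · refine ⟨p, eq_singleton_iff_unique_mem.2 ⟨?_, fun q hq => ?_⟩⟩
      · rw [mem_inter, mem_toLeft]; exact ⟨hCZ, mem_blocks_inl.1 hlC⟩
      · rw [mem_inter, mem_toLeft] at hq
        exact Sum.inl_injective (hCu _ ⟨hq.1, mem_blocks_inl.2 hq.2⟩)
    · rw [mem_blocks_inr] at hlC
      exact absurd (hlC.trans ((hmi j).1 hCZ)) hli
  have h2 := hL.two_le
  have hNL : Z.toLeft ∉ L := by
    intro hm
    by_cases hci : c Z.toLeft = i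
    · have := hpar _ hm hci
      rw [disjoint_self_iff_empty] at this
      rw [this, card_empty] at hN; omega
    · have := hmeet _ hm hci
      rw [inter_self] at this; omega
  have hne : ∀ l ∈ L, l ≠ Z.toLeft := by rintro l hl rfl; exact hNL hl
  have hle : ∀ l ∈ L, (Z.toLeft ∩ l).card ≤ 1 := by
    intro l hl
    by_cases hci : c l = i
    · rw [disjoint_iff_inter_eq_empty.1 (hpar l hl hci)]; simp
    · exact (hmeet l hl hci).le
  have hiff : ∀ l ∈ L, c l = i ↔ Disjoint Z.toLeft l := by
    refine fun l hl => ⟨hpar l hl, fun hd => ?_⟩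
    by_contra hci
    have := hmeet l hl hci
    rw [disjoint_iff_inter_eq_empty.1 hd] at this
    simp at this
  refine ⟨Z.toLeft, hNL, ⟨h2, hL.card_points, ?_, ?_⟩, Function.update c Z.toLeft i, ?_⟩
  · intro l hl
    rcases mem_insert.1 hl with rfl | hl
    exacts [hN, hL.card_line l hl]
  · intro l hl m hm hlm
    rcases mem_insert.1 hl with hlN | hl <;> rcases mem_insert.1 hm with hmN | hm
    · exact absurd (hlN.trans hmN.symm) hlm
    · rw [hlN]; exact hle m hm
    · rw [hmN, inter_comm]; exact hle l hl
    · exact hL.card_inter_le_one l hl m hm hlm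
  · intro l hl m hm
    rcases mem_insert.1 hl with hlN | hl <;> rcases mem_insert.1 hm with hmN | hm
    · rw [hlN, hmN]; exact ⟨fun _ => Or.inl rfl, fun _ => rfl⟩
    · rw [hlN, Function.update_self, Function.update_of_ne (hne m hm), eq_comm, hiff m hm]
      exact ⟨Or.inr, fun h0 => h0.resolve_left (hne m hm).symm⟩
    · rw [hmN, Function.update_self, Function.update_of_ne (hne l hl), hiff l hl, disjoint_comm]
      exact ⟨Or.inr, fun h0 => h0.resolve_left (hne l hl)⟩
    · rw [Function.update_of_ne (hne l hl), Function.update_of_ne (hne m hm)]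
      exact hc l hl m hm

variable [Fintype K]

theorem isRegularLinearSpace_blocks (hL : IsPartialAffinePlane n L) (hc : IsClassMap L c) :
    IsRegularLinearSpace n (blocks L c) := by
  constructor
  · intro l
    rw [card_filter_sum_type]
    simp only [mem_blocks_inl, mem_blocks_inr, filter_univ_mem]
    rw [hL.card_line l.1 l.2]
    simp [filter_eq]
  · intro l m hlm
    rw [card_filter_sum_type]
    simp only [mem_blocks_inl, mem_blocks_inr]
    have hne : l.1 ≠ m.1 := fun h0 => hlm (Subtype.ext h0)
    have h1 := hL.card_inter_le_one l.1 l.2 m.1 m.2 hne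
    have h2 : (univ.filter fun p => p ∈ l.1 ∧ p ∈ m.1) = l.1 ∩ m.1 := by ext; simp
    rw [h2]
    by_cases hcl : c l.1 = c m.1
    · have hp := ((hc l.1 l.2 m.1 m.2).1 hcl).resolve_left hne
      rw [disjoint_iff_inter_eq_empty.1 hp]
      simp [hcl, filter_eq]
    · have hp : ¬ Disjoint l.1 m.1 := fun h0 => hcl ((hc l.1 l.2 m.1 m.2).2 (Or.inr h0))
      rw [disjoint_iff_inter_eq_empty, ← card_eq_zero] at hp
      have h3 : (univ.filter fun i => c l.1 = i ∧ c m.1 = i) = ∅ := by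
        rw [filter_eq_empty_iff]
        rintro i - ⟨h4, h5⟩
        exact hcl (h4.trans h5.symm)
      rw [h3, card_empty]; omega

theorem inr_mem_nbrs_inr {i j : K} :
    Sum.inr j ∈ nbrs (blocks L c) (Sum.inr i) ↔ j ≠ i := by
  rw [mem_nbrs]
  refine ⟨fun h0 hji => h0.1 (by rw [hji]), fun h0 => ⟨fun h1 => h0 (Sum.inr_injective h1), ?_⟩⟩
  rw [disjoint_left]
  intro l hl hl'
  rw [mem_blocks_inr] at hl hl'
  exact h0 (hl'.symm.trans hl)

theorem toRight_nbrs_inr (i : K) :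
    (nbrs (blocks L c) (Sum.inr i)).toRight = univ.erase i := by
  ext j
  rw [mem_toRight, inr_mem_nbrs_inr, mem_erase]
  simp

theorem card_toRight_nbrs_inl (hc : IsClassMap L c) (p : P) :
    (nbrs (blocks L c) (Sum.inl p)).toRight.card + (blocks L c (Sum.inl p)).card
      = Fintype.card K := by
  have h1 : (nbrs (blocks L c) (Sum.inl p)).toRight
      = ((blocks L c (Sum.inl p)).image fun l => c l.1)ᶜ := by
    ext i
    rw [mem_toRight, mem_nbrs, mem_compl, mem_image, disjoint_left]
    simp only [mem_blocks_inr, ne_eq, reduceCtorEq, not_false_eq_true, true_and, not_exists,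
      not_and]
  rw [h1, ← card_image_of_injOn (s := blocks L c (Sum.inl p)) (f := fun l => c l.1),
    add_comm, card_add_card_compl]
  intro l hl m hm hlm
  exact eq_of_mem_blocks hc hlm hl hm

end Blocks
-- Adding lines up to completion
section Step

variable {P : Type*} [DecidableEq P] {n : ℕ} {L : Finset (Finset P)}
  {c : Finset P → Fin (n + 1)} {e : ℤ}

theorem sum_deficit_inr :
    ∑ i, deficit n (blocks L c) (Sum.inr i) = (n + 1) ^ 2 - L.card := by
  simp only [deficit, sum_sub_distrib, sum_card_blocks_inr, sum_const, card_univ, Fintype.card_fin,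
    nsmul_eq_mul]
  push_cast; ring

/-- A parallel class of blocks contains at most one class of lines if it misses a full class. -/
theorem card_toRight_le_one (hc : IsClassMap L c)
    {Z : Finset (P ⊕ Fin (n + 1))} (hZ : IsParallelClass n (blocks L c) Z) {t : Fin (n + 1)}
    (ht : deficit n (blocks L c) (Sum.inr t) = 1) (htZ : Sum.inr t ∉ Z) :
    Z.toRight.card ≤ 1 := by
  -- The `n` pairwise disjoint lines of the class `t` need `n` different points of `Z`.
  have hex : ∀ l ∈ blocks L c (Sum.inr t), ∃ p ∈ Z.toLeft, l ∈ blocks L c (Sum.inl p) := by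
    intro l hl
    obtain ⟨C, ⟨hCZ, hlC⟩, -⟩ := hZ.existsUnique_mem l
    rcases C with p | j
    · exact ⟨p, mem_toLeft.2 hCZ, hlC⟩
    · rw [mem_blocks_inr] at hl hlC
      rw [← hlC, hl] at hCZ
      exact absurd hCZ htZ
  have hle : (blocks L c (Sum.inr t)).card ≤ Z.toLeft.card := by
    rcases isEmpty_or_nonempty P with hP | hP
    · have : blocks L c (Sum.inr t) = ∅ := by
        by_contra h0
        obtain ⟨l, hl⟩ := nonempty_iff_ne_empty.2 h0
        obtain ⟨p, -⟩ := hex l hl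
        exact hP.elim p
      rw [this]; simp
    · choose! g hg using hex
      refine card_le_card_of_injOn g (fun l hl => (hg l hl).1) fun l hl m hm hlm => ?_
      have h2 := (hg m hm).2
      rw [← hlm] at h2
      refine eq_of_mem_blocks hc ?_ (hg l hl).2 h2
      exact (mem_blocks_inr.1 hl).trans (mem_blocks_inr.1 hm).symm
  have h2 := card_toLeft_add_card_toRight (u := Z)
  rw [hZ.card_eq] at h2
  simp only [deficit] at ht
  omega

variable [Fintype P]

theorem card_sum_fin (hL : IsPartialAffinePlane n L) :
    Fintype.card (P ⊕ Fin (n + 1)) = n ^ 2 + n + 1 := by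
  rw [Fintype.card_sum, hL.card_points, Fintype.card_fin, add_assoc]

theorem deficit_pos_of_mem_nbrs (hL : IsPartialAffinePlane n L) (hc : IsClassMap L c)
    {C D : P ⊕ Fin (n + 1)} (hCD : C ∈ nbrs (blocks L c) D) : 0 < deficit n (blocks L c) D := by
  have h1 := card_nbrs (card_sum_fin hL) (isRegularLinearSpace_blocks hL hc) D
  have h2 : (0 : ℤ) < (nbrs (blocks L c) D).card := by exact_mod_cast card_pos.2 ⟨C, hCD⟩
  rw [h1] at h2
  exact pos_of_mul_pos_right h2 (by positivity)

theorem deficit_inl_nonneg (hc : IsClassMap L c) (p : P) :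
    0 ≤ deficit n (blocks L c) (Sum.inl p) := by
  have h1 := card_toRight_nbrs_inl hc p
  rw [Fintype.card_fin] at h1
  simp only [deficit]; omega

theorem card_toRight_nbrs_inl_eq_deficit (hc : IsClassMap L c) (p : P) :
    ((nbrs (blocks L c) (Sum.inl p)).toRight.card : ℤ) = deficit n (blocks L c) (Sum.inl p) := by
  have h1 := card_toRight_nbrs_inl hc p
  rw [Fintype.card_fin] at h1
  simp only [deficit]; omega

/-- Distinct classes are always adjacent, so `n` of the neighbours are the other classes. -/
theorem card_toLeft_nbrs_inr (hL : IsPartialAffinePlane n L) (hc : IsClassMap L c)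
    (i : Fin (n + 1)) :
    ((nbrs (blocks L c) (Sum.inr i)).toLeft.card : ℤ)
      = n * (deficit n (blocks L c) (Sum.inr i) - 1) := by
  have h1 := card_nbrs (card_sum_fin hL) (isRegularLinearSpace_blocks hL hc) (Sum.inr i)
  rw [← card_toLeft_add_card_toRight, toRight_nbrs_inr, card_erase_of_mem (mem_univ i), card_univ,
    Fintype.card_fin] at h1
  rw [mul_sub, mul_one, ← h1]
  simp

theorem one_le_deficit_inr (hL : IsPartialAffinePlane n L) (hc : IsClassMap L c)
    (i : Fin (n + 1)) : 1 ≤ deficit n (blocks L c) (Sum.inr i) := by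
  have h1 := card_toLeft_nbrs_inr hL hc i
  have h2 := hL.two_le
  by_contra! hlt
  have : (n : ℤ) * (deficit n (blocks L c) (Sum.inr i) - 1) < 0 :=
    mul_neg_of_pos_of_neg (by omega) (by omega)
  omega

theorem two_le_deficit_inr (hL : IsPartialAffinePlane n L) (hc : IsClassMap L c)
    {i : Fin (n + 1)} {p : P} (hp : Sum.inl p ∈ nbrs (blocks L c) (Sum.inr i)) :
    2 ≤ deficit n (blocks L c) (Sum.inr i) := by
  have h1 := card_toLeft_nbrs_inr hL hc i
  have h2 := one_le_deficit_inr hL hc i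
  have h3 := card_pos.2 ⟨p, mem_toLeft.2 hp⟩
  by_contra! hlt
  rw [show deficit n (blocks L c) (Sum.inr i) - 1 = 0 by omega] at h1
  omega

/-- The points on no line of a class that lacks one line form a new line. -/
theorem exists_insert_of_deficit_inr_eq_two (hL : IsPartialAffinePlane n L) (hc : IsClassMap L c)
    {i : Fin (n + 1)} (hi : deficit n (blocks L c) (Sum.inr i) = 2) :
    ∃ N ∉ L, IsPartialAffinePlane n (insert N L) ∧
      ∃ c' : Finset P → Fin (n + 1), IsClassMap (insert N L) c' := by
  have hI := isRegularLinearSpace_blocks hL hc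
  set X : Finset (P ⊕ Fin (n + 1)) :=
    (nbrs (blocks L c) (Sum.inr i)).toLeft.map Function.Embedding.inl with hX
  have hXr : X.toRight = ∅ := by ext j; simp [hX]
  have hXl : X.toLeft = (nbrs (blocks L c) (Sum.inr i)).toLeft := by ext j; simp [hX]
  refine exists_insert_of_isParallelClass hL hc (Z := insert (Sum.inr i) X) ?_ ?_
  · apply isParallelClass_insert
    · intro C hC
      obtain ⟨p, hp, rfl⟩ := mem_map.1 hC
      exact mem_toLeft.1 hp
    · have := card_toLeft_nbrs_inr hL hc i
      rw [hi] at this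
      rw [hX, card_map]; omega
    · intro l hl
      have h2 := card_filter_mem_nbrs hI hl
      rw [hi, ← card_toLeft_add_card_toRight] at h2
      have h3 : ((nbrs (blocks L c) (Sum.inr i)).filter fun C => l ∈ blocks L c C).toRight
          = {c l.1} := by
        ext j
        rw [mem_toRight, mem_filter, inr_mem_nbrs_inr, mem_blocks_inr, mem_singleton, eq_comm (a := j)]
        rw [mem_blocks_inr] at hl
        exact ⟨fun h0 => h0.2, fun h0 => ⟨by rw [← h0]; exact hl, h0⟩⟩
      rw [h3, card_singleton] at h2
      have h4 : ((nbrs (blocks L c) (Sum.inr i)).filter fun C => l ∈ blocks L c C).toLeft.map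
          Function.Embedding.inl = X.filter fun C => l ∈ blocks L c C := by
        ext C
        rcases C with p | j <;> simp [hX]
      rw [← h4, card_map]
      push_cast at h2; omega
  · rw [toRight_insert_inr, hXr]; simp

theorem two_le_deficit_of_mem_nbrs_inl (hL : IsPartialAffinePlane n L) (hc : IsClassMap L c)
    (h1 : ∀ p, deficit n (blocks L c) (Sum.inl p) ≠ 1) {C : P ⊕ Fin (n + 1)} {p : P}
    (hCD : C ∈ nbrs (blocks L c) (Sum.inl p)) : 2 ≤ deficit n (blocks L c) C := by
  rcases C with q | j
  · have := deficit_pos_of_mem_nbrs hL hc (mem_nbrs_comm.1 hCD)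
    have := h1 q
    omega
  · exact two_le_deficit_inr hL hc (mem_nbrs_comm.1 hCD)

/-- In `sum_deficit_nbrs` the other classes contribute exactly `e + 1 - d`, where `d` is the deficit
of the class `i`. -/
theorem sum_toLeft_nbrs_inr (hL : IsPartialAffinePlane n L) (hc : IsClassMap L c)
    (he : (L.card : ℤ) = n ^ 2 - e) (i : Fin (n + 1)) :
    ∑ p ∈ (nbrs (blocks L c) (Sum.inr i)).toLeft, (deficit n (blocks L c) (Sum.inl p) - 2)
      = (deficit n (blocks L c) (Sum.inr i) - 1)
        * (e + 1 - deficit n (blocks L c) (Sum.inr i)) := by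
  have h1 := sum_deficit_nbrs (card_sum_fin hL) (isRegularLinearSpace_blocks hL hc)
    (by rw [Fintype.card_coe]; exact he) (Sum.inr i)
  rw [sum_eq_sum_toLeft_add_sum_toRight, toRight_nbrs_inr] at h1
  have h2 := add_sum_erase univ (fun j => deficit n (blocks L c) (Sum.inr j) - 2) (mem_univ i)
  have h3 : ∑ j, (deficit n (blocks L c) (Sum.inr j) - 2)
      = (n + 1) ^ 2 - L.card - 2 * (n + 1) := by
    rw [sum_sub_distrib, sum_deficit_inr]
    simp only [sum_const, card_univ, Fintype.card_fin, nsmul_eq_mul]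
    push_cast; ring
  rw [h3] at h2
  linarith

/-- Without points of deficit one, the excess sums have no negative terms; their closed forms then
bound the deficit. -/
theorem deficit_le_of_ne_one (hL : IsPartialAffinePlane n L) (hc : IsClassMap L c)
    (he : (L.card : ℤ) = n ^ 2 - e) (h1 : ∀ p, deficit n (blocks L c) (Sum.inl p) ≠ 1)
    {C : P ⊕ Fin (n + 1)} (hC : 2 ≤ deficit n (blocks L c) C) :
    deficit n (blocks L c) C ≤ e + 1 := by
  by_contra! hlt
  rcases C with p | i
  · have h2 := sum_deficit_nbrs (card_sum_fin hL) (isRegularLinearSpace_blocks hL hc)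
      (by rw [Fintype.card_coe]; exact he) (Sum.inl p)
    have h3 : 0 ≤ ∑ C ∈ nbrs (blocks L c) (Sum.inl p), (deficit n (blocks L c) C - 2) :=
      sum_nonneg fun C hC => by
        have := two_le_deficit_of_mem_nbrs_inl hL hc h1 hC; omega
    nlinarith
  · have h2 := sum_toLeft_nbrs_inr hL hc he i
    have h3 : 0 ≤ ∑ p ∈ (nbrs (blocks L c) (Sum.inr i)).toLeft,
        (deficit n (blocks L c) (Sum.inl p) - 2) :=
      sum_nonneg fun p hp => by
        have := deficit_pos_of_mem_nbrs hL hc (mem_nbrs_comm.1 (mem_toLeft.1 hp))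
        have := h1 p; omega
    nlinarith

/-- A partial affine plane with labelled classes that lacks few lines has a further line. -/
theorem exists_insert (hn : 49 ≤ n) (hL : IsPartialAffinePlane n L) (hc : IsClassMap L c) {E : ℕ}
    (hE : (E + 1) ^ 2 ≤ 2 * n) (hcard : n ^ 2 ≤ L.card + E) (hlt : L.card < n ^ 2 + n) :
    ∃ N ∉ L, IsPartialAffinePlane n (insert N L) ∧
      ∃ c' : Finset P → Fin (n + 1), IsClassMap (insert N L) c' := by
  have hI := isRegularLinearSpace_blocks hL hc
  have hb := card_sum_fin hL
  obtain ⟨e, he⟩ : ∃ e : ℤ, (L.card : ℤ) = n ^ 2 - e := ⟨n ^ 2 - L.card, by ring⟩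
  have hv : (Fintype.card {l // l ∈ L} : ℤ) = n ^ 2 - e := by rw [Fintype.card_coe]; exact he
  by_cases h1 : ∃ p, deficit n (blocks L c) (Sum.inl p) = 1
  · obtain ⟨p, hp⟩ := h1
    refine exists_insert_of_isParallelClass hL hc (isParallelClass_of_deficit_eq_one hb hI hp) ?_
    rw [toRight_insert_inl]
    have := card_toRight_nbrs_inl_eq_deficit hc p
    rw [hp] at this
    exact_mod_cast this
  by_cases h2 : ∃ i, deficit n (blocks L c) (Sum.inr i) = 2
  · obtain ⟨i, hi⟩ := h2
    exact exists_insert_of_deficit_inr_eq_two hL hc hi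
  push Not at h1 h2
  have hsum := sum_deficit_inr (c := c) (L := L) (n := n)
  zify at hE hcard hlt
  have heE : e ≤ E := by linarith
  obtain ⟨i, hi⟩ : ∃ i, 2 ≤ deficit n (blocks L c) (Sum.inr i) := by
    by_contra! hall
    have : ∑ i, deficit n (blocks L c) (Sum.inr i) ≤ ∑ i : Fin (n + 1), (1 : ℤ) :=
      sum_le_sum fun i _ => by have := hall i; omega
    rw [hsum] at this
    simp at this
    nlinarith
  have hie := deficit_le_of_ne_one hL hc he h1 hi
  have he2 : (e + 1) ^ 2 ≤ 2 * (n : ℤ) :=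
    (pow_le_pow_left₀ (by omega) (by omega) 2).trans hE
  have h5 := five_mul_le hn he2
  -- The class deficits sum to `2 * n + 1 + e < 3 * (n + 1)`, and none equals two.
  obtain ⟨t, ht⟩ : ∃ t, deficit n (blocks L c) (Sum.inr t) = 1 := by
    by_contra! hall
    have : ∑ i : Fin (n + 1), (3 : ℤ) ≤ ∑ i, deficit n (blocks L c) (Sum.inr i) :=
      sum_le_sum fun i _ => by
        have := hall i; have := h2 i; have := one_le_deficit_inr hL hc i; omega
    rw [hsum] at this
    simp at this
    linarith
  -- With `d` the deficit of the class `i`, it misses `n * (d - 1)` points, of total excess only `(d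
  -- - 1) * (e + 1 - d)`.
  obtain ⟨p, hpi, hp⟩ : ∃ p ∈ (nbrs (blocks L c) (Sum.inr i)).toLeft,
      deficit n (blocks L c) (Sum.inl p) = 2 := by
    by_contra! hall
    have h3 := sum_toLeft_nbrs_inr hL hc he i
    have h4 : ∑ p ∈ (nbrs (blocks L c) (Sum.inr i)).toLeft, (1 : ℤ)
        ≤ ∑ p ∈ (nbrs (blocks L c) (Sum.inr i)).toLeft,
          (deficit n (blocks L c) (Sum.inl p) - 2) :=
      sum_le_sum fun p hp => by
        have := deficit_pos_of_mem_nbrs hL hc (mem_nbrs_comm.1 (mem_toLeft.1 hp))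
        have := h1 p; have := hall p hp; omega
    rw [h3, sum_const, nsmul_eq_mul, mul_one, card_toLeft_nbrs_inr hL hc] at h4
    nlinarith
  have hN : ∀ C ∈ nbrs (blocks L c) (Sum.inl p),
      2 ≤ deficit n (blocks L c) C ∧ deficit n (blocks L c) C ≤ e + 1 := fun C hC => by
    have h3 := two_le_deficit_of_mem_nbrs_inl hL hc h1 hC
    exact ⟨h3, deficit_le_of_ne_one hL hc he h1 h3⟩
  obtain ⟨X, X', hX, hZ, hZ'⟩ := exists_parallelClass_pair hb hI hv hp hN hn he2
  have htN : Sum.inr t ∉ nbrs (blocks L c) (Sum.inl p) := fun h0 => by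
    have := (hN _ h0).1; omega
  rw [← hX, mem_union, not_or] at htN
  -- The point `p` misses two classes. Neither parallel class of blocks can take both, so each has
  -- exactly one.
  have k := card_toRight_le_one hc hZ ht (by simp [htN.1])
  have k' := card_toRight_le_one hc hZ' ht (by simp [htN.2])
  have hr := card_toRight_nbrs_inl_eq_deficit hc p
  rw [hp, ← hX, toRight_union] at hr
  have hu := card_union_le X.toRight X'.toRight
  refine exists_insert_of_isParallelClass hL hc hZ ?_
  rw [toRight_insert_inl] at k k' ⊢
  omega

/-- With `n ^ 2 + n` lines the plane is complete. -/
theorem isAffinePlane_of_le_card (hL : IsPartialAffinePlane n L) (hc : IsClassMap L c)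
    (hcard : n ^ 2 + n ≤ L.card) : IsAffinePlane n L := by
  have hI := isRegularLinearSpace_blocks hL hc
  have hb := card_sum_fin hL
  have h2 := hL.two_le
  have hzero : ∀ p, deficit n (blocks L c) (Sum.inl p) = 0 := by
    -- The sum equals `n ^ 2 * (n + 1) - n * L.card`.
    have hs : ∑ p, deficit n (blocks L c) (Sum.inl p) ≤ 0 := by
      simp only [deficit, sum_sub_distrib, sum_card_blocks_inl hL, sum_const, card_univ,
        hL.card_points, nsmul_eq_mul]
      zify at hcard
      push_cast
      nlinarith
    have h0 := (sum_eq_zero_iff_of_nonneg fun p _ => deficit_inl_nonneg hc p).1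
      (hs.antisymm (sum_nonneg fun p _ => deficit_inl_nonneg hc p))
    exact fun p => h0 p (mem_univ p)
  have hempty : ∀ p C, C ∉ nbrs (blocks L c) (Sum.inl p) := by
    intro p C hC
    have := deficit_pos_of_mem_nbrs hL hc hC
    rw [hzero] at this
    exact lt_irrefl _ this
  have hmeet : ∀ p C, C ≠ Sum.inl p →
      ∃ l, l ∈ blocks L c (Sum.inl p) ∧ l ∈ blocks L c C := by
    intro p C hC
    by_contra! h0
    exact hempty p C (mem_nbrs.2 ⟨hC, disjoint_left.2 h0⟩)
  have huniq : ∀ l ∈ L, ∀ m ∈ L, ∀ p q, p ≠ q → p ∈ l → q ∈ l → p ∈ m → q ∈ m → l = m := by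
    intro l hl m hm p q hpq hpl hql hpm hqm
    by_contra hlm
    exact hpq (card_le_one.1 (hL.card_inter_le_one l hl m hm hlm) p (by simp [hpl, hpm]) q
      (by simp [hql, hqm]))
  refine ⟨h2, hL.card_points, hL.card_line, ?_, ?_, ?_⟩
  · intro p q hpq
    obtain ⟨l, hl, hl'⟩ := hmeet p (Sum.inl q) fun h0 => hpq (Sum.inl_injective h0).symm
    rw [mem_blocks_inl] at hl hl'
    exact ⟨l.1, ⟨l.2, hl, hl'⟩, fun m hm => huniq m hm.1 l.1 l.2 p q hpq hm.2.1 hm.2.2 hl hl'⟩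
  · intro l hl p hp
    obtain ⟨m, hm, hm'⟩ := hmeet p (Sum.inr (c l)) (by simp)
    rw [mem_blocks_inl] at hm
    rw [mem_blocks_inr] at hm'
    have hlm : l ≠ m.1 := by rintro rfl; exact hp hm
    refine ⟨m.1, ⟨m.2, hm, ((hc l hl m.1 m.2).1 hm'.symm).resolve_left hlm⟩, ?_⟩
    rintro k ⟨hk, hpk, hlk⟩
    have hck := (hc l hl k hk).2 (Or.inr hlk)
    rcases (hc k hk m.1 m.2).1 (hck.symm.trans hm'.symm) with h0 | h0
    · exact h0
    · exact absurd hm (disjoint_left.1 h0 hpk)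
  · have hLne : L.Nonempty := card_pos.1 (by nlinarith)
    obtain ⟨l, hl⟩ := hLne
    have hcl := hL.card_line l hl
    obtain ⟨q, hq, r, hr, hqr⟩ := one_lt_card.1 (by omega : 1 < l.card)
    obtain ⟨p, hp⟩ : ∃ p, p ∉ l := by
      by_contra! hall
      have h3 := hL.card_points
      rw [← card_univ, ← eq_univ_iff_forall.2 hall, hcl] at h3
      nlinarith
    refine ⟨p, q, r, ?_⟩
    rintro ⟨m, hm, hpm, hqm, hrm⟩
    have := huniq l hl m hm q r hqr hq hr hqm hrm
    exact hp (this ▸ hpm)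

theorem extendsToAffinePlane_of_isClassMap (hn : 49 ≤ n) (hL : IsPartialAffinePlane n L)
    (hc : IsClassMap L c) {E : ℕ} (hE : (E + 1) ^ 2 ≤ 2 * n) (hcard : n ^ 2 ≤ L.card + E) :
    ExtendsToAffinePlane n L := by
  induction hk : n ^ 2 + n - L.card generalizing L c with
  | zero => exact ⟨L, Subset.rfl, isAffinePlane_of_le_card hL hc (by omega)⟩
  | succ k ih =>
    obtain ⟨N, hN, hLN, c', hc'⟩ := exists_insert hn hL hc hE hcard (by omega)
    have h1 := card_insert_of_notMem hN
    obtain ⟨L', hL', hA⟩ := ih hLN hc' (by omega) (by omega)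
    exact ⟨L', (subset_insert N L).trans hL', hA⟩

end Step
-- At most `n + 1` parallel classes
/-- The numerical core of the bound on the number of parallel classes. -/
theorem false_of_class_counts {P K : Type*} [Fintype P] [Fintype K] (w : P → ℤ) (f : K → ℤ)
    (Z : Finset P) {n e : ℤ} (hn : 49 ≤ n) (hk : n + 2 ≤ Fintype.card K)
    (hw : ∀ p, 0 ≤ w p) (hwe : ∀ p ∉ Z, w p ≤ e) (hZ : ∀ p ∈ Z, w p = n)
    (hf : ∀ i, 0 ≤ f i) (hfe : ∀ i, f i ≤ e) (hF : ∑ i, f i = Fintype.card K * n - n ^ 2 + e)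
    (hW : ∑ p, w p = n * e) (hW2 : ∑ p, w p ^ 2 = e ^ 2 + n * ∑ i, f i - ∑ i, f i ^ 2)
    (hZf : ∀ i, Z.card * n ≤ f i * (n + e - f i))
    (hsmall : e ^ 2 < n ∨ (e + 1) ^ 2 ≤ 2 * n ∧ Z = ∅) : False := by
  classical
  have hsumZ : ∀ a : ℤ, (∑ p, if p ∈ Z then a else 0) = Z.card * a := by
    intro a; rw [← sum_filter, filter_mem_eq_inter, univ_inter, sum_const, nsmul_eq_mul]
  have he0 : 0 ≤ e := by
    have : 0 ≤ n * e := hW ▸ sum_nonneg fun p _ => hw p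
    exact nonneg_of_mul_nonneg_right this (by linarith)
  have hen : e ≤ n := by
    rcases hsmall with h0 | ⟨h0, -⟩ <;> nlinarith
  have u1 : ∑ p, w p ^ 2 ≤ e * (n * e) + Z.card * (n ^ 2 - e * n) := by
    rw [← hW, mul_sum, ← hsumZ, ← sum_add_distrib]
    apply sum_le_sum
    intro p _
    split_ifs with h0
    · rw [hZ p h0]; linarith
    · have := mul_le_mul_of_nonneg_right (hwe p h0) (hw p)
      linarith [sq (w p)]
  have u2 : ∑ i, f i ^ 2 ≤ e * ∑ i, f i := by
    rw [mul_sum]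
    exact sum_le_sum fun i _ => by
      rw [sq]; exact mul_le_mul_of_nonneg_right (hfe i) (hf i)
  obtain ⟨C, hC⟩ : ∃ C : ℤ, (Fintype.card K : ℤ) = n + 1 + C := ⟨Fintype.card K - n - 1, by ring⟩
  have hC1 : 1 ≤ C := by linarith
  have hF' : ∑ i, f i = n * (C + 1) + e := by rw [hF, hC]; ring
  rw [hW2, hF'] at u1
  rw [hF'] at u2
  -- Upper bounds for both second moments, compared through `hW2` and divided by `n`. If `Z` is
  -- empty, this alone gives `2 * n ≤ e ^ 2 + e`.
  have key : n + (n - e) * (C - Z.card) ≤ e ^ 2 := by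
    have : n * (n + (n - e) * (C - Z.card)) ≤ n * e ^ 2 := by linarith
    exact le_of_mul_le_mul_left this (by linarith)
  rcases hsmall with hA | ⟨hB, hZ0⟩
  · have hzC : C + 1 ≤ Z.card := by
      by_contra! hlt
      have := mul_nonneg (sub_nonneg.2 hen) (by linarith : (0 : ℤ) ≤ C - Z.card)
      linarith
    have hfz : ∀ i, (Z.card : ℤ) ≤ f i := by
      intro i
      by_contra! hlt
      have h1 := hZf i
      have h2 := mul_le_mul_of_nonneg_right (by linarith : f i + 1 ≤ Z.card)
        (by linarith : 0 ≤ n)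
      have h3 : f i * (e - f i) ≤ e ^ 2 := by nlinarith [hf i, hfe i]
      linarith
    have h4 : (Z.card : ℤ) * Fintype.card K ≤ ∑ i, f i := by
      have := sum_le_sum fun i (_ : i ∈ (univ : Finset K)) => hfz i
      rw [sum_const, card_univ, nsmul_eq_mul] at this
      linarith
    have hz : (Z.card : ℤ) = C + 1 := by
      refine le_antisymm ?_ hzC
      by_contra! hlt
      have h5 := mul_le_mul_of_nonneg_right (by linarith : C + 1 + 1 ≤ (Z.card : ℤ))
        (by linarith : 0 ≤ n + 1 + C)
      rw [hF', hC] at h4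
      nlinarith
    -- Now `Z` has `C + 1` points and every `f i` is at least that. Using these as lower bounds for
    -- the second moments reverses the estimate and yields `n ≤ e ^ 2`.
    have u3 : (Z.card : ℤ) * (n ^ 2 - n) ≤ ∑ p, w p ^ 2 - ∑ p, w p := by
      rw [← sum_sub_distrib, ← hsumZ]
      apply sum_le_sum
      intro p _
      split_ifs with h0
      · rw [hZ p h0]
      · have := hw p
        rcases this.eq_or_lt with h1 | h1
        · rw [← h1]; norm_num
        · nlinarith
    have u4 : (Z.card : ℤ) * ∑ i, f i ≤ ∑ i, f i ^ 2 := by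
      rw [mul_sum]
      exact sum_le_sum fun i _ => by
        rw [sq]; exact mul_le_mul_of_nonneg_right (hfz i) (hf i)
    rw [hW2, hW, hF', hz] at u3
    rw [hF', hz] at u4
    have h6 : (C + 1) * C * n + (C + 1) * e ≤ e ^ 2 := by linarith
    have h7 : 1 * n ≤ ((C + 1) * C) * n :=
      mul_le_mul_of_nonneg_right (by nlinarith) (by linarith)
    have h8 := mul_nonneg (by linarith : 0 ≤ C + 1) he0
    linarith
  · rw [hZ0, card_empty, Nat.cast_zero, sub_zero] at key
    have := mul_le_mul_of_nonneg_left hC1 (sub_nonneg.2 hen)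
    linarith

section ClassCount

variable {P K : Type*} [Fintype P] [DecidableEq P] [Fintype K] [DecidableEq K]
  {n : ℕ} {L : Finset (Finset P)} {c : Finset P → K}

theorem sum_inter_blocks_inl (hL : IsPartialAffinePlane n L) (hc : IsClassMap L c) (i : K) :
    ∑ p, ((blocks L c (Sum.inr i) ∩ blocks L c (Sum.inl p)).card : ℤ)
      = n * (blocks L c (Sum.inr i)).card := by
  have h1 := sum_card_inter (isRegularLinearSpace_blocks hL hc) (blocks L c (Sum.inr i))
  rw [Fintype.sum_sum_type] at h1
  have h2 : ∑ j, ((blocks L c (Sum.inr i) ∩ blocks L c (Sum.inr j)).card : ℤ)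
      = (blocks L c (Sum.inr i)).card := by
    rw [sum_eq_single i]
    · rw [inter_self]
    · intro j _ hji
      have := (mem_nbrs.1 (inr_mem_nbrs_inr (L := L) (c := c) |>.2 hji)).2
      rw [disjoint_iff_inter_eq_empty.1 this]; simp
    · simp
  rw [h2] at h1
  linarith

theorem card_blocks_inr_le (hL : IsPartialAffinePlane n L) (hc : IsClassMap L c) (i : K) :
    (blocks L c (Sum.inr i)).card ≤ n := by
  have h1 := sum_inter_blocks_inl hL hc i
  have h2 : ∑ p, ((blocks L c (Sum.inr i) ∩ blocks L c (Sum.inl p)).card : ℤ)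
      ≤ ∑ p : P, (1 : ℤ) := sum_le_sum fun p _ => by
    exact_mod_cast card_inter_le_one (isRegularLinearSpace_blocks hL hc) (by simp)
  rw [h1] at h2
  simp only [sum_const, card_univ, hL.card_points, nsmul_eq_mul, mul_one] at h2
  have h3 : n * (blocks L c (Sum.inr i)).card ≤ n * n := by rw [← sq]; exact_mod_cast h2
  exact Nat.le_of_mul_le_mul_left h3 (by have := hL.two_le; omega)

theorem sum_card_blocks_of_mem (hL : IsPartialAffinePlane n L) (hc : IsClassMap L c)
    (l : {l // l ∈ L}) :
    ∑ p ∈ l.1, ((blocks L c (Sum.inl p)).card : ℤ) + (blocks L c (Sum.inr (c l.1))).card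
      = L.card + n := by
  have h1 := sum_card_inter_mul_card_inter (isRegularLinearSpace_blocks hL hc) {l} univ
  simp only [univ_inter, inter_univ, card_singleton, card_univ, Fintype.card_coe] at h1
  have h2 : ∀ C, ((({l} : Finset _) ∩ blocks L c C).card : ℤ)
      = if l ∈ blocks L c C then 1 else 0 := by
    intro C; rw [card_inter_eq_sum, sum_singleton]
  rw [Fintype.sum_sum_type] at h1
  simp only [h2, mem_blocks_inl, mem_blocks_inr, ite_mul, one_mul, zero_mul] at h1
  rw [sum_ite_eq, ← sum_filter, filter_univ_mem, if_pos (mem_univ _)] at h1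
  push_cast at h1
  linarith

theorem sum_sq_card_blocks (hL : IsPartialAffinePlane n L) (hc : IsClassMap L c) :
    ∑ p, ((blocks L c (Sum.inl p)).card : ℤ) ^ 2 + ∑ i, ((blocks L c (Sum.inr i)).card : ℤ) ^ 2
      = (L.card : ℤ) ^ 2 + n * L.card := by
  have h1 := sum_card_inter_mul_card_inter (isRegularLinearSpace_blocks hL hc) univ univ
  rw [Fintype.sum_sum_type] at h1
  simp only [univ_inter, card_univ, Fintype.card_coe, ← sq] at h1
  exact h1

/-- A class missing `p` has a line off `p`, one of whose `n + 1` blocks is thus disjoint from `p`.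
If no class misses `p`, its degree is at least `n + 2`, too large unless all lines pass through `p`;
counting incidences excludes that. -/
theorem card_blocks_inl_le (hL : IsPartialAffinePlane n L) (hc : IsClassMap L c)
    (hs : ∀ i, ∃ l ∈ L, c l = i) (hk : n + 2 ≤ Fintype.card K) (p : P) :
    (blocks L c (Sum.inl p)).card ≤ n := by
  have hI := isRegularLinearSpace_blocks hL hc
  have h1 := card_toRight_nbrs_inl hc p
  rcases (nbrs (blocks L c) (Sum.inl p)).toRight.eq_empty_or_nonempty with h0 | ⟨i, hi⟩
  · rw [h0, card_empty, zero_add] at h1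
    by_cases hall : ∀ l, l ∈ blocks L c (Sum.inl p)
    · have hu : blocks L c (Sum.inl p) = univ := eq_univ_iff_forall.2 hall
      have h2 := sum_card_blocks_inl (c := c) hL
      rw [← add_sum_erase univ _ (mem_univ p), hu, card_univ, Fintype.card_coe] at h2
      have h3 : ∑ q ∈ univ.erase p, ((blocks L c (Sum.inl q)).card : ℤ)
          ≤ ∑ q ∈ univ.erase p, (1 : ℤ) := sum_le_sum fun q hq => by
        have := card_inter_le_one hI (B := Sum.inl p) (C := Sum.inl q)
          fun h4 => ne_of_mem_erase hq (Sum.inl_injective h4)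
        rw [hu, univ_inter] at this
        exact_mod_cast this
      rw [hu, card_univ, Fintype.card_coe] at h1
      rw [sum_const, card_erase_of_mem (mem_univ p), card_univ, hL.card_points, nsmul_eq_mul,
        mul_one, Nat.cast_sub (Nat.one_le_pow _ _ (by have := hL.two_le; omega))] at h3
      have h5 := hL.two_le
      have h6 : n + 2 ≤ L.card := by omega
      zify at h5 h6
      push_cast at h3
      nlinarith
    · push Not at hall
      obtain ⟨l, hl⟩ := hall
      have := card_filter_mem_nbrs hI hl
      simp only [deficit] at this
      omega
  · rw [mem_toRight] at hi
    obtain ⟨l, hl, hli⟩ := hs i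
    have hli' : (⟨l, hl⟩ : {l // l ∈ L}) ∈ blocks L c (Sum.inr i) := mem_blocks_inr.2 hli
    have h2 := card_filter_mem_nbrs hI (x := ⟨l, hl⟩)
      fun h3 => disjoint_left.1 (mem_nbrs.1 hi).2 h3 hli'
    have h3 := card_pos.2 ⟨_, mem_filter (p := fun C => ⟨l, hl⟩ ∈ blocks L c C).2 ⟨hi, hli'⟩⟩
    simp only [deficit] at h2
    omega

theorem card_classes_le (hn : 49 ≤ n) (hL : IsPartialAffinePlane n L) (hc : IsClassMap L c)
    (hs : ∀ i, ∃ l ∈ L, c l = i)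
    (hsmall : (n ^ 2 - L.card) ^ 2 < n ∨
      (n ^ 2 - L.card + 1) ^ 2 ≤ 2 * n ∧ ∀ p : P, ∃ l ∈ L, p ∈ l) :
    Fintype.card K ≤ n + 1 := by
  by_contra! hk
  have hr := card_blocks_inl_le hL hc hs hk
  obtain ⟨e, he⟩ : ∃ e : ℤ, (L.card : ℤ) = n ^ 2 - e := ⟨n ^ 2 - L.card, by ring⟩
  set w : P → ℤ := fun p => n - (blocks L c (Sum.inl p)).card with hw
  set f : K → ℤ := fun i => n - (blocks L c (Sum.inr i)).card with hf
  set Z : Finset P := univ.filter fun p => (blocks L c (Sum.inl p)).card = 0 with hZ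
  have hw0 : ∀ p, 0 ≤ w p := fun p => by have := hr p; simp only [hw]; omega
  have hf0 : ∀ i, 0 ≤ f i := fun i => by
    have := card_blocks_inr_le hL hc i; simp only [hf]; omega
  have hline : ∀ l : {l // l ∈ L}, ∑ p ∈ l.1, w p = e - f (c l.1) := by
    intro l
    have h1 := sum_card_blocks_of_mem hL hc l
    simp only [hw, hf, sum_sub_distrib, sum_const, hL.card_line l.1 l.2, nsmul_eq_mul]
    linarith [sq (n : ℤ)]
  have hW : ∑ p, w p = n * e := by
    simp only [hw, sum_sub_distrib, sum_card_blocks_inl hL, sum_const, card_univ, hL.card_points,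
      nsmul_eq_mul, he]
    push_cast; ring
  have he0 : 0 ≤ e := by
    have : 0 ≤ (n : ℤ) * e := hW ▸ sum_nonneg fun p _ => hw0 p
    exact nonneg_of_mul_nonneg_right this (by omega)
  have hF : ∑ i, f i = Fintype.card K * n - n ^ 2 + e := by
    simp only [hf, sum_sub_distrib, sum_card_blocks_inr, sum_const, card_univ, nsmul_eq_mul, he]
    ring
  have hsq := sum_sq_card_blocks hL hc
  refine false_of_class_counts w f Z (n := n) (e := e) (by exact_mod_cast hn) (by omega) hw0 ?_ ?_
    hf0 ?_ hF hW ?_ ?_ ?_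
  · intro p hp
    rw [hZ, mem_filter, not_and] at hp
    obtain ⟨l, hl⟩ := card_pos.1 (Nat.pos_of_ne_zero (hp (mem_univ p)))
    rw [mem_blocks_inl] at hl
    have h1 := single_le_sum (fun q _ => hw0 q) hl
    have h2 := hline l
    have h3 := hf0 (c l.1)
    linarith
  · intro p hp
    have := (mem_filter.1 hp).2
    simp only [hw, this]; simp
  · intro i
    obtain ⟨l, hl, rfl⟩ := hs i
    have h1 : 0 ≤ ∑ p ∈ l, w p := sum_nonneg fun p _ => hw0 p
    have h2 := hline ⟨l, hl⟩
    linarith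
  · have h1 : ∀ a : ℤ, ((n : ℤ) - a) ^ 2 = n ^ 2 - 2 * n * a + a ^ 2 := fun a => by ring
    have h2 := sum_card_blocks_inl (c := c) hL
    have h3 := sum_card_blocks_inr (c := c) (L := L)
    simp only [hw, hf, h1, sum_add_distrib, sum_sub_distrib, ← mul_sum, sum_const, card_univ,
      hL.card_points, nsmul_eq_mul, h2, h3]
    rw [he] at hsq ⊢
    push_cast
    linarith
  · intro i
    -- Sum `w` over the points covered by the class `i`. The points of `Z` are uncovered and have
    -- weight `n` each, so they fit into the rest of the total `n * e`.
    have h1 : ∑ p, w p * ((blocks L c (Sum.inr i) ∩ blocks L c (Sum.inl p)).card : ℤ)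
        = (n - f i) * (e - f i) := by
      have h2 : ∀ p, w p * ((blocks L c (Sum.inr i) ∩ blocks L c (Sum.inl p)).card : ℤ)
          = ∑ l ∈ blocks L c (Sum.inr i), if p ∈ l.1 then w p else 0 := by
        intro p
        rw [card_inter_eq_sum, mul_sum]
        simp only [mem_blocks_inl, mul_ite, mul_one, mul_zero]
      simp only [h2]
      rw [sum_comm]
      have h3 : ∀ l ∈ blocks L c (Sum.inr i), (∑ p, if p ∈ l.1 then w p else 0) = e - f i := by
        intro l hl
        rw [← sum_filter, filter_univ_mem, hline l, mem_blocks_inr.1 hl]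
      rw [sum_congr rfl h3, sum_const, nsmul_eq_mul]
      simp only [hf]; ring
    have h4 : ∑ p, w p * ((blocks L c (Sum.inr i) ∩ blocks L c (Sum.inl p)).card : ℤ)
        ≤ ∑ p, (w p - if p ∈ Z then (n : ℤ) else 0) := by
      apply sum_le_sum
      intro p _
      split_ifs with hp
      · have h5 := (mem_filter.1 hp).2
        rw [card_eq_zero] at h5
        simp only [hw, h5]; simp
      · have h5 : (blocks L c (Sum.inr i) ∩ blocks L c (Sum.inl p)).card ≤ 1 :=
          card_inter_le_one (isRegularLinearSpace_blocks hL hc) (by simp)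
        have h6 : ((blocks L c (Sum.inr i) ∩ blocks L c (Sum.inl p)).card : ℤ) ≤ 1 := by
          exact_mod_cast h5
        have := mul_le_mul_of_nonneg_left h6 (hw0 p)
        linarith
    rw [h1, sum_sub_distrib, hW, ← sum_filter, filter_univ_mem, sum_const, nsmul_eq_mul] at h4
    linarith
  · have hle : L.card ≤ n ^ 2 := by zify; linarith
    have hE : ((n ^ 2 - L.card : ℕ) : ℤ) = e := by
      rw [Nat.cast_sub hle]; push_cast; linarith
    rcases hsmall with h1 | ⟨h1, h2⟩
    · left
      rw [← hE]; exact_mod_cast h1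
    · right
      refine ⟨by rw [← hE]; exact_mod_cast h1, filter_eq_empty_iff.2 fun p _ h3 => ?_⟩
      obtain ⟨l, hl, hpl⟩ := h2 p
      exact (card_pos.2 ⟨⟨l, hl⟩, mem_blocks_inl.2 hpl⟩).ne' h3

end ClassCount

/-! ### Assembling the theorem -/

theorem exists_isClassMap.{u} {P : Type u} {L : Finset (Finset P)} (hpar : ParallelismIsEquivalence L)
    (hne : L.Nonempty) :
    ∃ (K : Type u) (_ : Fintype K) (c : Finset P → K), IsClassMap L c ∧ ∀ i, ∃ l ∈ L, c l = i := by
  classical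
  obtain ⟨l₀, hl₀⟩ := hne
  let s : Setoid {l // l ∈ L} := ⟨_, hpar⟩
  refine ⟨Quotient s, inferInstance,
    fun l => if hl : l ∈ L then Quotient.mk s ⟨l, hl⟩ else Quotient.mk s ⟨l₀, hl₀⟩, ?_, ?_⟩
  · intro l hl m hm
    simp only [hl, hm, dif_pos]
    exact Quotient.eq
  · intro i
    obtain ⟨⟨l, hl⟩, rfl⟩ := Quotient.exists_rep i
    exact ⟨l, hl, by simp only [hl, dif_pos]⟩

theorem extendsToAffinePlane {n : ℕ} (hn : 49 ≤ n) {P : Type*} [Fintype P] [DecidableEq P]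
    {L : Finset (Finset P)} (hL : IsPartialAffinePlane n L) (hpar : ParallelismIsEquivalence L)
    (hE : (n ^ 2 - L.card + 1) ^ 2 ≤ 2 * n)
    (hsmall : (n ^ 2 - L.card) ^ 2 < n ∨ ∀ p : P, ∃ l ∈ L, p ∈ l) :
    ExtendsToAffinePlane n L := by
  classical
  have hne : L.Nonempty := by
    rw [nonempty_iff_ne_empty]
    rintro rfl
    rw [card_empty, Nat.sub_zero] at hE
    nlinarith
  obtain ⟨K, _, c, hc, hs⟩ := exists_isClassMap hpar hne
  have hK := card_classes_le hn hL hc hs (hsmall.imp_right fun h0 => ⟨hE, h0⟩)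
  rw [← Fintype.card_fin (n + 1)] at hK
  obtain ⟨g⟩ := Function.Embedding.nonempty_of_card_le hK
  have hc' : IsClassMap L (g ∘ c) := fun l hl m hm => by
    rw [Function.comp_apply, Function.comp_apply, g.injective.eq_iff]; exact hc l hl m hm
  exact extendsToAffinePlane_of_isClassMap hn hL hc' hE (by omega)

end PartialAffine

theorem mainTheorem3 (n : ℕ) (hn : 49 ≤ n) {P : Type*} [Fintype P] [DecidableEq P]
    (L : Finset (Finset P)) (hL : IsPartialAffinePlane n L)
    (hpar : ParallelismIsEquivalence L) :
    ((n : ℝ) ^ 2 - √(n : ℝ) < (L.card : ℝ) → ExtendsToAffinePlane n L) ∧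
    ((n : ℝ) ^ 2 - √(2 * (n : ℝ)) + 1 ≤ (L.card : ℝ) → (∀ p : P, ∃ l ∈ L, p ∈ l) →
      ExtendsToAffinePlane n L) := by
  have hn' : (49 : ℝ) ≤ n := by exact_mod_cast hn
  constructor
  · intro h
    -- The natural subtraction is zero when `L` has at least `n ^ 2` lines, so that case is
    -- separate.
    have h1 : ((n ^ 2 - L.card : ℕ) : ℝ) < √(n : ℝ) := by
      rcases le_total L.card (n ^ 2) with h0 | h0
      · rw [Nat.cast_sub h0]; push_cast; linarith
      · rw [Nat.sub_eq_zero_of_le h0]; simp only [Nat.cast_zero]; positivity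
    have h2 : (n ^ 2 - L.card) ^ 2 < n := by
      have := (Real.lt_sqrt (by positivity)).1 h1
      exact_mod_cast this
    refine PartialAffine.extendsToAffinePlane hn hL hpar ?_ (Or.inl h2)
    generalize n ^ 2 - L.card = E at h2
    nlinarith
  · intro h hp
    have h1 : ((n ^ 2 - L.card : ℕ) : ℝ) + 1 ≤ √(2 * (n : ℝ)) := by
      rcases le_total L.card (n ^ 2) with h0 | h0
      · rw [Nat.cast_sub h0]; push_cast; linarith
      · rw [Nat.sub_eq_zero_of_le h0]
        simp only [Nat.cast_zero, zero_add]
        exact Real.one_le_sqrt.2 (by linarith)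
    have h2 : (n ^ 2 - L.card + 1) ^ 2 ≤ 2 * n := by
      have := (Real.le_sqrt (by positivity) (by positivity)).1 h1
      exact_mod_cast this
    exact PartialAffine.extendsToAffinePlane hn hL hpar h2 (Or.inr hp)
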